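/- **Setting.** Let $(X,d)$ be a metric space whose topology is Polish (for instance a complete separable metric space), $\mathfrak m$ a $\sigma$-finite Borel measure on $X$, and $N\ge 2$. Let $\rho\colon X\to[0,\infty)$ be a Borel function such that $\rho\mathfrak m$ is a probability measure and $\rho\log\rho\in L^1_{\mathfrak m}(X)$. Let $f\colon(0,\infty)\to\mathbb R$ be continuous and decreasing (not necessarily strictly) with $\lim_{t\to0+}f(t)=+\infty$; put $f(0):=+\infty$ and $$c(x_1,\dots,x_N)=\sum_{1\le i<j\le N}f(d(x_i,x_j)),\qquad (x_1,\dots,x_N)\in X^N .$$ Assume $$\text{(A)}\quad \lim_{r\to0+}\ \sup_{x\in X}\int_{B(x,r)}\rho\,d\mathfrak m<\frac1{N(N-1)^2},$$ $$\text{(B)}\quad \int_{X\setminus B(o,r_0)}f(2d(x,o))\,\rho(x)\,d\mathfrak m(x)>-\infty\quad\text{for some } o\in X \text{ and some } r_0>0 .$$ Let $\mathcal P^{\mathrm{sym}}(X^N)$ be the set of Borel probability measures on $X^N$ that are invariant under permutations of the coordinates, with the topology of narrow convergence, and let $\Pi_N(\rho)$ be the set of Borel probability measures on $X^N$ all of whose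 $N$ one-point marginals equal $\rho\mathfrak m$. Write $\mathfrak m_N$ for the $N$-fold product of $\mathfrak m$, $C_0[\gamma]=\int_{X^N}c\,d\gamma$, and $$E[\gamma]=\int_{X^N}\rho_\gamma\log\rho_\gamma\,d\mathfrak m_N\ \text{ if }\gamma=\rho_\gamma\mathfrak m_N\ll\mathfrak m_N,\qquad E[\gamma]=+\infty\ \text{ otherwise.}$$ Let $(\tau_n)_{n\in\mathbb N}$ be positive real numbers decreasing to $0$. For $\gamma\in\mathcal P^{\mathrm{sym}}(X^N)$ put $$\mathcal C_n[\gamma]=\begin{cases}C_0[\gamma]+\tau_nE[\gamma]&\gamma\in\Pi_N(\rho)\\+\infty&\text{otherwise}\end{cases}\qquad \mathcal C[\gamma]=\begin{cases}C_0[\gamma]&\gamma\in\Pi_N(\rho)\\+\infty&\text{otherwise.}\end{cases}$$ **Theorem 3.1.** The functionals $\mathcal C_n$ and $\mathcal C$ take values in $(-\infty,+\infty]$, and $\mathcal C_n$ $\Gamma$-converges to $\mathcal C$ in $\mathcal P^{\mathrm{sym}}(X^N)$. That is, for every $\gamma\in\mathcal P^{\mathrm{sym}}(X^N)$: (I) for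 each sequence $(\gamma_n)$ in $\mathcal P^{\mathrm{sym}}(X^N)$ converging narrowly to $\gamma$, $\liminf_{n\to\infty}\mathcal C_n[\gamma_n]\ge\mathcal C[\gamma]$; (II) there is a sequence $(\gamma_n)$ in $\mathcal P^{\mathrm{sym}}(X^N)$ converging narrowly to $\gamma$ with $\limsup_{n\to\infty}\mathcal C_n[\gamma_n]\le\mathcal C[\gamma]$. Moreover, if $\gamma\in\Pi_N(\rho)$ and $C_0[\gamma]<+\infty$, the sequence in (II) can be chosen such that $C_0[\gamma_n]\to C_0[\gamma]$ and, for every $n$: $\gamma_n\in\Pi_N(\rho)$; $\gamma_n$ is a finite sum of product measures $\nu_1\otimes\cdots\otimes\nu_N$ of finite Borel measures on $X$; $E[\gamma_n]<+\infty$; and for some $\alpha_n>0$, $\gamma_n(\{x\in X^N: d(x_i,x_j)<\alpha_n\text{ for some }i\ne j\})=0$. -/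

import Mathlib

open MeasureTheory Filter Topology
open scoped ENNReal

noncomputable section

namespace RepulsiveOT

/-- Integral of an extended-real function, `∫ g⁺ dμ - ∫ g⁻ dμ`. It is meaningful when one of the two
terms is finite; by the convention `⊤ - ⊤ = ⊥` of `EReal`, a value `> ⊥` always means that the
negative part has a finite integral. -/
def extIntegral {Y : Type*} [MeasurableSpace Y] (μ : Measure Y) (g : Y → EReal) : EReal :=
  ((∫⁻ y, (g y).toENNReal ∂μ : ℝ≥0∞) : EReal) - ((∫⁻ y, (-g y).toENNReal ∂μ : ℝ≥0∞) : EReal)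

/-- Sequential Gamma-convergence of extended-real functionals on a topological space. -/
def GammaConverges {Y : Type*} [TopologicalSpace Y] (F : ℕ → Y → EReal) (G : Y → EReal) : Prop :=
  (∀ y : Y, ∀ u : ℕ → Y, Tendsto u atTop (𝓝 y) → G y ≤ liminf (fun n => F n (u n)) atTop) ∧
  (∀ y : Y, ∃ u : ℕ → Y, Tendsto u atTop (𝓝 y) ∧ limsup (fun n => F n (u n)) atTop ≤ G y)

/-- The pair interaction on `[0, ∞)`: the function `f` on `(0, ∞)`, with the value `+∞` at `0`. -/
def pairCost (f : ℝ → ℝ) (t : ℝ) : EReal := if t = 0 then ⊤ else (f t : EReal)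

/-- `f` (only its values on `(0, ∞)` matter) is continuous and decreasing on `(0, ∞)`, and tends to
`+∞` at `0`. -/
structure IsRepulsive (f : ℝ → ℝ) : Prop where
  continuousOn : ContinuousOn f (Set.Ioi 0)
  antitoneOn : AntitoneOn f (Set.Ioi 0)
  tendsto_zero : Tendsto f (𝓝[>] 0) atTop

section

variable {X : Type*} [MetricSpace X] {N : ℕ}

/-- The repulsive cost `c(x₁, …, x_N) = ∑_{i < j} f (d(x_i, x_j))`. -/
def cost (f : ℝ → ℝ) (x : Fin N → X) : EReal :=
  ∑ p : Fin N × Fin N with p.1 < p.2, pairCost f (dist (x p.1) (x p.2))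

/-- The open `α`-neighbourhood `D_α` of the diagonals in `X^N`. -/
def nearDiagonal (X : Type*) [MetricSpace X] (N : ℕ) (α : ℝ) : Set (Fin N → X) :=
  {x | ∃ i j, i ≠ j ∧ dist (x i) (x j) < α}

variable [MeasurableSpace X]

/-- The measure `ρ m`. -/
def densityMeasure (m : Measure X) (ρ : X → ℝ) : Measure X :=
  m.withDensity (fun x => ENNReal.ofReal (ρ x))

/-- Condition (A): `lim_{r → 0} sup_x μ(B(x, r)) < 1 / (N (N - 1)²)`. -/
def ConditionA (N : ℕ) (μ : Measure X) : Prop :=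
  ∃ L : ℝ≥0∞, Tendsto (fun r : ℝ => ⨆ x : X, μ (Metric.ball x r)) (𝓝[>] 0) (𝓝 L) ∧
    L < ENNReal.ofReal (1 / ((N : ℝ) * ((N : ℝ) - 1) ^ 2))

/-- Condition (B): `∫_{X ∖ B(o, r₀)} f (2 d(x, o)) dμ(x) > -∞` for some `o` and `r₀ > 0`. -/
def ConditionB (f : ℝ → ℝ) (μ : Measure X) : Prop :=
  ∃ o : X, ∃ r₀ : ℝ, 0 < r₀ ∧
    ⊥ < extIntegral (μ.restrict (Metric.ball o r₀)ᶜ) (fun x => pairCost f (2 * dist x o))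

/-- The space of symmetric (permutation invariant) Borel probability measures on `X^N`; as a subtype
of `ProbabilityMeasure` it carries the topology of narrow convergence. -/
abbrev SymProb (X : Type*) [MeasurableSpace X] (N : ℕ) : Type _ :=
  {γ : ProbabilityMeasure (Fin N → X) //
    ∀ σ : Equiv.Perm (Fin N), (γ : Measure (Fin N → X)).map (fun x => x ∘ σ) = γ}

/-- All `N` one-point marginals of `γ` equal `μ`. -/
def IsCoupling (μ : Measure X) (γ : ProbabilityMeasure (Fin N → X)) : Prop :=
  ∀ i : Fin N, (γ : Measure (Fin N → X)).map (fun x => x i) = μ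

/-- The transport cost `C₀[γ] = ∫ c dγ`. -/
def transportCost (f : ℝ → ℝ) (γ : ProbabilityMeasure (Fin N → X)) : EReal :=
  extIntegral (γ : Measure (Fin N → X)) (cost f)

open Classical in
/-- The entropy `E[γ] = ∫ ρ_γ log ρ_γ dm_N` if `γ ≪ m_N`, and `+∞` otherwise, where `m_N` is the
`N`-fold product of `m` and `ρ_γ` the density of `γ` with respect to `m_N`. -/
def entropy (m : Measure X) [SigmaFinite m] (γ : ProbabilityMeasure (Fin N → X)) : EReal :=
  if (γ : Measure (Fin N → X)) ≪ Measure.pi (fun _ : Fin N => m) then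
    extIntegral (Measure.pi (fun _ : Fin N => m)) (fun x =>
      ((((γ : Measure (Fin N → X)).rnDeriv (Measure.pi (fun _ : Fin N => m)) x).toReal *
        Real.log ((γ : Measure (Fin N → X)).rnDeriv (Measure.pi (fun _ : Fin N => m)) x).toReal
        : ℝ) : EReal))
  else ⊤

open Classical in
/-- The functional `C_ε = C₀ + ε E` on the symmetric probability measures, set to `+∞` off the
couplings of `ρ m`. -/
def regularizedFunctional (m : Measure X) [SigmaFinite m] (ρ : X → ℝ) (f : ℝ → ℝ) (ε : ℝ)
    (γ : SymProb X N) : EReal :=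
  if IsCoupling (densityMeasure m ρ) γ.1 then
    transportCost f γ.1 + (ε : EReal) * entropy m γ.1
  else ⊤

open Classical in
/-- The functional `C₀` on the symmetric probability measures, set to `+∞` off the couplings of
`ρ m`. -/
def limitFunctional (m : Measure X) (ρ : X → ℝ) (f : ℝ → ℝ) (γ : SymProb X N) : EReal :=
  if IsCoupling (densityMeasure m ρ) γ.1 then transportCost f γ.1 else ⊤

/-- `γ` is a block measure: a finite sum of product measures `ν₁ ⊗ ⋯ ⊗ ν_N` of finite measures. -/
def IsBlock (γ : ProbabilityMeasure (Fin N → X)) : Prop :=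
  ∃ (M : ℕ) (ν : Fin M → Fin N → Measure X), (∀ k i, IsFiniteMeasure (ν k i)) ∧
    (γ : Measure (Fin N → X)) = ∑ k, Measure.pi (ν k)

end

end RepulsiveOT

end

/-!
The functionals are compared through a nonnegative cost. With `h(x) = max(0, -f(2 d(x, o)))`, which
is integrable by condition (B), the compensated cost `∑_{i < j} (f(d(x_i, x_j)) + h(x_i) + h(x_j))`
is a continuous function with values in `[0, ∞]` (`IsRepulsive.continuous_compCost`), and on the
couplings of `μ = ρ m` its integral differs from the transport cost by a finite constant
(`IsRepulsive.transportCost_eq`). Hence the transport cost is narrowly lower semicontinuous on the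
couplings. The entropies of the couplings are bounded below by a constant depending on
`∫ ρ |log ρ| dm` only (`IsCoupling.le_entropy`), so that `τ n` times the entropy is asymptotically
nonnegative; this gives the lower bound of the Gamma-convergence (`limitFunctional_le_liminf`).

For the upper bound, let `γ` be a symmetric coupling of finite cost. The space is cut into finitely
many labelled cells at two scales (`exists_labelling`): fine cells of small diameter carrying almost
all the mass, and coarse cells, each either contained in a ball of the fixed radius `2 r` or at
distance at least `r` from the fine cells. Recording the labels only, `γ` becomes a coupling `g` on
a finite set. Its good tuples consist of fine cells that are bounded and away from the diagonals;
the other tuples carry a small mass. A bad tuple is repaired with the help of `N - 1` independent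
good tuples: arranged as the rows of an `N × N` array, the `N` tuples are regrouped along a cyclic
Latin square (`regroup`), which does not change the marginals, and each regrouped tuple has at most
one entry from the bad one. By condition (A), a union bound over `N² (N - 1) / 2` pairs of entries
shows that the regrouped tuples are `r`-separated with probability bounded below
(`le_sum_admissible`, `ConditionA.exists_radius`). Conditioning on this event costs a bounded factor,
so a small fraction of the good mass is enough (`exists_rearrangement`).

The resulting weights on tuples of labels, spread over the cells as `μ^{⊗ N}`, define a symmetric
block coupling with a bounded density with respect to `μ^{⊗ N}`, hence of finite entropy
(`IsCoupling.entropy_lt_top`). It avoids a neighbourhood of the diagonals and is close to `γ`. On the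
good part the compensated cost is uniformly continuous; on the repaired part it is at most a constant
plus terms in `h`, which are small by uniform integrability. Therefore the cost is almost that of `γ`
(`exists_block_approximation`). Running slowly enough through a sequence of such approximations makes
`τ n` times the entropy tend to zero (`exists_recovery_sequence`).
-/

noncomputable section

namespace RepulsiveOT

/-! ### Rearrangement of discrete couplings -/

section Discrete

variable {N : ℕ} {L : Type*}

/-- Regrouping of an `N × N` array of labels: the `i`-th regrouped tuple takes its `j`-th entry from
the `j`-th entry of the row `j - i` (a cyclic Latin square). Every row contributes exactly one entry
to every regrouped tuple, and the `j`-th entries of the regrouped tuples are the `j`-th entries of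
the rows. -/
def regroup [NeZero N] (Y : Fin N → Fin N → L) (i : Fin N) : Fin N → L := fun j => Y (j - i) j

variable [Fintype L]

theorem sum_prod_eq_prod_sum {ι α : Type*} [Fintype ι] [DecidableEq ι] [Fintype α]
    (w : ι → α → ℝ) : ∑ Y : ι → α, ∏ k, w k (Y k) = ∏ k, ∑ y, w k y := by
  rw [Finset.prod_univ_sum, Fintype.piFinset_univ]

/-- For a product of subprobability weights, the event that the rows `a ≠ b` are in relation `B` has
weight at most `κ` as soon as this holds conditionally on the row `a`. -/
theorem sum_prod_ite_le {ι α : Type*} [Fintype ι] [DecidableEq ι] [Fintype α] [DecidableEq α]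
    (w : ι → α → ℝ) (hw : ∀ k y, 0 ≤ w k y) (hw1 : ∀ k, ∑ y, w k y ≤ 1) {a b : ι} (hab : a ≠ b)
    (B : α → α → Prop) [∀ y, DecidablePred (B y)] {κ : ℝ} (hκ : 0 ≤ κ)
    (hB : ∀ y, ∑ y', (if B y y' then w b y' else 0) ≤ κ) :
    ∑ Y : ι → α, (if B (Y a) (Y b) then ∏ k, w k (Y k) else 0) ≤ κ := by
  have key : ∀ Y : ι → α, (if B (Y a) (Y b) then ∏ k, w k (Y k) else 0) =
      ∑ y, ∏ k, (if k = a then (if Y k = y then w k (Y k) else 0) else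
        if k = b then (if B y (Y k) then w k (Y k) else 0) else w k (Y k)) := by
    intro Y
    rw [Finset.sum_eq_single (Y a)]
    · split_ifs with h
      · refine Finset.prod_congr rfl fun k _ => ?_
        split_ifs with h1 h2 h3 h4
        · rfl
        · exact absurd (by rw [h1]) h2
        · rfl
        · exact absurd (by rwa [h3]) h4
        · rfl
      · symm
        apply Finset.prod_eq_zero (Finset.mem_univ b)
        rw [if_neg hab.symm, if_pos rfl, if_neg h]
    · intro y _ hy
      apply Finset.prod_eq_zero (Finset.mem_univ a)
      rw [if_pos rfl, if_neg (Ne.symm hy)]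
    · simp
  simp_rw [key]
  rw [Finset.sum_comm]
  calc _ = ∑ y, ∏ k, ∑ y', (if k = a then (if y' = y then w k y' else 0) else
        if k = b then (if B y y' then w k y' else 0) else w k y') := by
        refine Finset.sum_congr rfl fun y _ => ?_
        rw [← sum_prod_eq_prod_sum]
    _ ≤ ∑ y, ∏ k, (if k = a then w a y else if k = b then κ else 1) := by
        refine Finset.sum_le_sum fun y _ => Finset.prod_le_prod ?_ ?_
        · intro k _
          refine Finset.sum_nonneg fun y' _ => ?_
          split_ifs <;> first | exact hw _ _ | exact le_rfl
        · intro k _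
          by_cases h1 : k = a
          · subst h1; simp
          · by_cases h2 : k = b
            · subst h2; simpa [h1] using hB y
            · simpa [h1, h2] using hw1 k
    _ = ∑ y, w a y * κ := by
        refine Finset.sum_congr rfl fun y _ => ?_
        rw [← Finset.mul_prod_erase Finset.univ _ (Finset.mem_univ a), if_pos rfl,
          ← Finset.mul_prod_erase (Finset.univ.erase a) _
            (Finset.mem_erase.2 ⟨hab.symm, Finset.mem_univ b⟩), if_neg hab.symm, if_pos rfl,
          Finset.prod_eq_one, mul_one]
        intro k hk
        simp only [Finset.mem_erase] at hk
        rw [if_neg hk.2.1, if_neg hk.1]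
    _ ≤ κ := by
        rw [← Finset.sum_mul]
        exact mul_le_of_le_one_left hκ (hw1 a)

/-- All the tuples obtained by regrouping the array `Y` have pairwise separated entries. -/
def Admissible [NeZero N] (sep : L → L → Prop) (Y : Fin N → Fin N → L) : Prop :=
  ∀ i j j', j < j' → sep (regroup Y i j) (regroup Y i j')

open Classical in
/-- Union bound: if the rows are drawn independently, the row `0` being arbitrary and the others
following `g`, then the regrouped tuples are all separated with probability bounded below. -/
theorem le_sum_admissible [NeZero N] (sep : L → L → Prop) (hsymm : ∀ l l', sep l l' → sep l' l)
    (w : Fin N → (Fin N → L) → ℝ) (hw : ∀ k y, 0 ≤ w k y) (hw1 : ∀ k, ∑ y, w k y ≤ 1)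
    {κ : ℝ} (hκ : 0 ≤ κ)
    (hsep : ∀ k, k ≠ 0 → ∀ (j : Fin N) (l : L),
      ∑ y : Fin N → L, (if ¬ sep l (y j) then w k y else 0) ≤ κ) :
    ∏ k, ∑ y, w k y - (N : ℝ) ^ 2 * ((N : ℝ) - 1) / 2 * κ ≤
      ∑ Y : Fin N → Fin N → L, if Admissible sep Y then ∏ k, w k (Y k) else 0 := by
  set P : Finset (Fin N × Fin N) := Finset.univ.filter fun q => q.1 < q.2 with hP
  have hPcard : (P.card : ℝ) = (N : ℝ) * ((N : ℝ) - 1) / 2 := by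
    have h1 : P.card = N.choose 2 := by
      have := Finset.card_powersetCard 2 (Finset.univ : Finset (Fin N))
      rw [Finset.card_univ, Fintype.card_fin] at this
      rw [← this]
      refine Finset.card_bij (fun q _ => {q.1, q.2}) ?_ ?_ ?_
      · intro q hq
        simp only [hP, Finset.mem_filter, Finset.mem_univ, true_and] at hq
        simp [Finset.mem_powersetCard, Finset.card_pair hq.ne]
      · rintro ⟨a, b⟩ ha ⟨a', b'⟩ hb heq
        simp only [hP, Finset.mem_filter, Finset.mem_univ, true_and] at ha hb
        have h1 : a ∈ ({a', b'} : Finset (Fin N)) := by rw [← heq]; simp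
        have h2 : b ∈ ({a', b'} : Finset (Fin N)) := by rw [← heq]; simp
        have h3 : a' ∈ ({a, b} : Finset (Fin N)) := by rw [heq]; simp
        simp only [Finset.mem_insert, Finset.mem_singleton] at h1 h2 h3
        rcases h1 with rfl | rfl <;> rcases h2 with rfl | rfl
        · exact absurd ha (lt_irrefl _)
        · rfl
        · exact absurd ha (not_lt.2 hb.le)
        · exact absurd ha (lt_irrefl _)
      · intro s hs
        rw [Finset.mem_powersetCard] at hs
        obtain ⟨a, b, hab, rfl⟩ := Finset.card_eq_two.1 hs.2
        rcases lt_or_gt_of_ne hab with h | h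
        · exact ⟨(a, b), by simp [hP, h], rfl⟩
        · exact ⟨(b, a), by simp [hP, h], Finset.pair_comm _ _⟩
    rw [h1, Nat.cast_choose_two]
  have hpt : ∀ Y : Fin N → Fin N → L, ∏ k, w k (Y k) ≤
      (if Admissible sep Y then ∏ k, w k (Y k) else 0) +
      ∑ i, ∑ q ∈ P, if ¬ sep (Y (q.1 - i) q.1) (Y (q.2 - i) q.2) then ∏ k, w k (Y k) else 0 := by
    intro Y
    have h0 : 0 ≤ ∏ k, w k (Y k) := Finset.prod_nonneg fun k _ => hw _ _
    have hterm : ∀ i (q : Fin N × Fin N), 0 ≤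
        (if ¬ sep (Y (q.1 - i) q.1) (Y (q.2 - i) q.2) then ∏ k, w k (Y k) else 0) := by
      intro i q; split_ifs <;> simp [h0]
    by_cases h : Admissible sep Y
    · rw [if_pos h]
      exact le_add_of_nonneg_right
        (Finset.sum_nonneg fun i _ => Finset.sum_nonneg fun q _ => hterm i q)
    · rw [if_neg h, zero_add]
      simp only [Admissible, not_forall] at h
      obtain ⟨i, j, j', hj, hn⟩ := h
      calc ∏ k, w k (Y k) =
          (if ¬ sep (Y (j - i) j) (Y (j' - i) j') then ∏ k, w k (Y k) else 0) := by
            rw [if_pos (by exact hn)]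
        _ ≤ ∑ q ∈ P, (if ¬ sep (Y (q.1 - i) q.1) (Y (q.2 - i) q.2) then ∏ k, w k (Y k) else 0) :=
            Finset.single_le_sum (f := fun q : Fin N × Fin N =>
              if ¬ sep (Y (q.1 - i) q.1) (Y (q.2 - i) q.2) then ∏ k, w k (Y k) else 0)
              (a := (j, j')) (fun q _ => hterm i q) (by simp [hP, hj])
        _ ≤ _ := Finset.single_le_sum (f := fun i => ∑ q ∈ P,
              (if ¬ sep (Y (q.1 - i) q.1) (Y (q.2 - i) q.2) then ∏ k, w k (Y k) else 0))
              (fun i _ => Finset.sum_nonneg fun q _ => hterm i q) (Finset.mem_univ i)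
  have hsum := Finset.sum_le_sum fun Y (_ : Y ∈ Finset.univ) => hpt Y
  rw [sum_prod_eq_prod_sum, Finset.sum_add_distrib] at hsum
  have hbad : ∑ Y : Fin N → Fin N → L, ∑ i, ∑ q ∈ P,
      (if ¬ sep (Y (q.1 - i) q.1) (Y (q.2 - i) q.2) then ∏ k, w k (Y k) else 0) ≤
      (N : ℝ) ^ 2 * ((N : ℝ) - 1) / 2 * κ := by
    rw [Finset.sum_comm]
    calc _ ≤ ∑ _i : Fin N, ∑ _q ∈ P, κ := by
          refine Finset.sum_le_sum fun i _ => ?_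
          rw [Finset.sum_comm]
          refine Finset.sum_le_sum fun q hq => ?_
          have hne : q.1 - i ≠ q.2 - i := by
            intro h
            have := sub_left_injective h
            simp only [hP, Finset.mem_filter] at hq
            exact hq.2.ne this
          by_cases h0 : q.2 - i = 0
          · have h1 : q.1 - i ≠ 0 := fun h => hne (h.trans h0.symm)
            have := sum_prod_ite_le w hw hw1 hne.symm
              (fun y y' => ¬ sep (y q.2) (y' q.1)) hκ (fun y => hsep _ h1 q.1 (y q.2))
            refine le_trans (le_of_eq ?_) this
            refine Finset.sum_congr rfl fun Y _ => ?_
            have hiff : sep (Y (q.1 - i) q.1) (Y (q.2 - i) q.2) ↔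
              sep (Y (q.2 - i) q.2) (Y (q.1 - i) q.1) := ⟨hsymm _ _, hsymm _ _⟩
            simp only [hiff]
          · exact sum_prod_ite_le w hw hw1 hne
              (fun y y' => ¬ sep (y q.1) (y' q.2)) hκ (fun y => hsep _ h0 q.2 (y q.1))
      _ = _ := by
          rw [Finset.sum_const, Finset.sum_const, Finset.card_univ, Fintype.card_fin, nsmul_eq_mul,
            nsmul_eq_mul, hPcard]
          ring
  linarith


theorem sum_prod_ite_eq_le {ι α : Type*} [Fintype ι] [DecidableEq ι] [Fintype α] [DecidableEq α]
    (w : ι → α → ℝ) (hw : ∀ k y, 0 ≤ w k y) (hw1 : ∀ k, ∑ y, w k y ≤ 1) (a : ι) (y₀ : α) :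
    ∑ Y : ι → α, (if Y a = y₀ then ∏ k, w k (Y k) else 0) ≤ w a y₀ := by
  have key : ∀ Y : ι → α, (if Y a = y₀ then ∏ k, w k (Y k) else 0) =
      ∏ k, (if k = a then (if Y k = y₀ then w k (Y k) else 0) else w k (Y k)) := by
    intro Y
    split_ifs with h
    · refine Finset.prod_congr rfl fun k _ => ?_
      split_ifs with h1 h2
      · rfl
      · exact absurd (by rw [h1, h]) h2
      · rfl
    · symm
      apply Finset.prod_eq_zero (Finset.mem_univ a)
      rw [if_pos rfl, if_neg h]
  simp_rw [key]
  rw [sum_prod_eq_prod_sum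
    (fun k y => if k = a then (if y = y₀ then w k y else 0) else w k y)]
  calc _ ≤ ∏ k, (if k = a then w a y₀ else 1) := by
        refine Finset.prod_le_prod (fun k _ => Finset.sum_nonneg fun y' _ => ?_) fun k _ => ?_
        · split_ifs <;> first | exact hw _ _ | exact le_rfl
        · by_cases h1 : k = a
          · subst h1; simp
          · simpa [h1] using hw1 k
    _ = w a y₀ := by simp

theorem sum_mul_sum_fiber {α β : Type*} [Fintype α] [Fintype β] [DecidableEq β] (F : α → β)
    (w : α → ℝ) (φ : β → ℝ) :
    ∑ t, (∑ Y, if F Y = t then w Y else 0) * φ t = ∑ Y, w Y * φ (F Y) := by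
  simp_rw [Finset.sum_mul]
  rw [Finset.sum_comm]
  simp [ite_mul]

open Classical in
/-- Discrete rearrangement. Let `g` be a coupling of `N` copies of `p`, and let the tuples that are
not `Good` carry a mass at most `δ`. Each bad tuple is combined with `N - 1` good ones, drawn
independently conditionally on the regrouped tuples being separated, and replaced by the regrouped
tuples. As every label is far from most of the good ones, the density of the good mass that is used
up is at most `(N - 1) δ / z`, so there is enough of it. -/
theorem exists_rearrangement [NeZero N] (sep : L → L → Prop) (hsymm : ∀ l l', sep l l' → sep l' l)
    (p : L → ℝ) (g : (Fin N → L) → ℝ) (hg : ∀ k, 0 ≤ g k) (hg1 : ∑ k, g k = 1)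
    (hmarg : ∀ (j : Fin N) (φ : L → ℝ), ∑ k, g k * φ (k j) = ∑ l, p l * φ l)
    (Good : (Fin N → L) → Prop) (Fine : L → Prop) (hGF : ∀ k, Good k → ∀ j, Fine (k j))
    {κ δ z : ℝ} (hκ : 0 ≤ κ) (hsep : ∀ l, ∑ l', (if Fine l' ∧ ¬ sep l l' then p l' else 0) ≤ κ)
    (hδ : ∑ k, (if Good k then 0 else g k) ≤ δ) (hδ1 : δ ≤ 1) (hz0 : 0 < z)
    (hz : z ≤ (1 - δ) ^ (N - 1) - (N : ℝ) ^ 2 * ((N : ℝ) - 1) / 2 * κ)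
    (hδz : ((N : ℝ) - 1) * δ ≤ z) :
    ∃ g₀ e : (Fin N → L) → ℝ, (∀ k, 0 ≤ g₀ k) ∧ (∀ k, 0 ≤ e k) ∧
      (∀ k, g₀ k ≤ if Good k then g k else 0) ∧
      (∀ k, e k ≠ 0 → ∀ j j', j ≠ j' → sep (k j) (k j')) ∧ ∑ k, e k ≤ N * δ ∧
      ∀ (j : Fin N) (φ : L → ℝ), ∑ k, (g₀ k + e k) * φ (k j) = ∑ l, p l * φ l := by
  set g' : (Fin N → L) → ℝ := fun k => if Good k then g k else 0 with hg'
  set b : (Fin N → L) → ℝ := fun k => if Good k then 0 else g k with hb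
  have hg'0 : ∀ k, 0 ≤ g' k := fun k => by simp only [hg']; split_ifs <;> simp [hg]
  have hb0 : ∀ k, 0 ≤ b k := fun k => by simp only [hb]; split_ifs <;> simp [hg]
  have hsplit : ∀ k, g k = g' k + b k := fun k => by simp only [hg', hb]; split_ifs <;> simp
  have hsum : ∑ k, g' k + ∑ k, b k = 1 := by
    rw [← Finset.sum_add_distrib, ← hg1]
    exact Finset.sum_congr rfl fun k _ => (hsplit k).symm
  have hbnn : 0 ≤ ∑ k, b k := Finset.sum_nonneg fun k _ => hb0 k
  have hg'1 : ∑ k, g' k ≤ 1 := by linarith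
  have hg'δ : 1 - δ ≤ ∑ k, g' k := by linarith
  set w : (Fin N → L) → Fin N → (Fin N → L) → ℝ :=
    fun x k y => if k = 0 then (if y = x then 1 else 0) else g' y with hw
  have hw0 : ∀ x k y, 0 ≤ w x k y := by
    intro x k y; simp only [hw]; split_ifs <;> simp [hg'0]
  have hw1 : ∀ x k, ∑ y, w x k y ≤ 1 := by
    intro x k
    by_cases h : k = 0
    · simp [hw, h]
    · simpa [hw, h] using hg'1
  set q : (Fin N → L) → (Fin N → Fin N → L) → ℝ :=
    fun x Y => if Admissible sep Y then ∏ k, w x k (Y k) else 0 with hq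
  have hq0 : ∀ x Y, 0 ≤ q x Y := by
    intro x Y; simp only [hq]
    split_ifs
    · exact Finset.prod_nonneg fun k _ => hw0 _ _ _
    · exact le_rfl
  have hqx : ∀ x Y, Y 0 ≠ x → q x Y = 0 := by
    intro x Y h
    simp only [hq]
    split_ifs
    · apply Finset.prod_eq_zero (Finset.mem_univ 0)
      simp [hw, h]
    · rfl
  set Z : (Fin N → L) → ℝ := fun x => ∑ Y, q x Y with hZ
  have hZz : ∀ x, z ≤ Z x := by
    intro x
    refine hz.trans (le_trans ?_ (le_sum_admissible sep hsymm (w x) (hw0 x) (hw1 x) hκ ?_))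
    · have hprod : ∏ k, ∑ y, w x k y = (∑ y, g' y) ^ (N - 1) := by
        rw [← Finset.mul_prod_erase Finset.univ _ (Finset.mem_univ 0)]
        have h0 : ∑ y, w x 0 y = 1 := by simp [hw]
        rw [h0, one_mul, Finset.prod_congr rfl (g := fun _ => ∑ y, g' y), Finset.prod_const,
          Finset.card_erase_of_mem (Finset.mem_univ _), Finset.card_univ, Fintype.card_fin]
        intro k hk
        simp [hw, (Finset.mem_erase.1 hk).1]
      rw [hprod]
      have := pow_le_pow_left₀ (by linarith : 0 ≤ 1 - δ) hg'δ (N - 1)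
      linarith
    · intro k hk j l
      calc ∑ y : Fin N → L, (if ¬ sep l (y j) then w x k y else 0) ≤
          ∑ y : Fin N → L, g y * (if Fine (y j) ∧ ¬ sep l (y j) then 1 else 0) := by
            refine Finset.sum_le_sum fun y _ => ?_
            simp only [hw, if_neg hk, hg']
            by_cases h1 : Good y
            · by_cases h2 : sep l (y j) <;> simp [h1, h2, hGF y h1 j]
            · by_cases h2 : sep l (y j) <;> by_cases h3 : Fine (y j) <;> simp [h1, h2, h3, hg]
        _ = ∑ l', p l' * (if Fine l' ∧ ¬ sep l l' then 1 else 0) :=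
            hmarg j (fun l' => if Fine l' ∧ ¬ sep l l' then 1 else 0)
        _ ≤ κ := by simpa [mul_ite] using hsep l
  have hZpos : ∀ x, 0 < Z x := fun x => hz0.trans_le (hZz x)
  set lam : (Fin N → Fin N → L) → ℝ := fun Y => ∑ x, b x / Z x * q x Y with hlam
  have hlam0 : ∀ Y, 0 ≤ lam Y := fun Y =>
    Finset.sum_nonneg fun x _ => mul_nonneg (div_nonneg (hb0 x) (hZpos x).le) (hq0 x Y)
  have hlamadm : ∀ Y, lam Y ≠ 0 → Admissible sep Y := by
    intro Y h
    by_contra hn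
    apply h
    simp [hlam, hq, hn]
  have hrow0 : ∀ φ : (Fin N → L) → ℝ, ∑ Y, lam Y * φ (Y 0) = ∑ x, b x * φ x := by
    intro φ
    simp only [hlam, Finset.sum_mul]
    rw [Finset.sum_comm]
    refine Finset.sum_congr rfl fun x _ => ?_
    have : ∀ Y, b x / Z x * q x Y * φ (Y 0) = (b x / Z x * φ x) * q x Y := by
      intro Y
      by_cases h : Y 0 = x
      · rw [h]; ring
      · rw [hqx x Y h]; ring
    simp_rw [this]
    rw [← Finset.mul_sum]
    change b x / Z x * φ x * Z x = _
    field_simp [(hZpos x).ne']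
  set r : Fin N → (Fin N → L) → ℝ := fun k y => ∑ Y, if Y k = y then lam Y else 0 with hr
  have hr0 : ∀ k y, 0 ≤ r k y := by
    intro k y
    refine Finset.sum_nonneg fun Y _ => ?_
    split_ifs <;> simp [hlam0]
  have hrle : ∀ k, k ≠ 0 → ∀ y, r k y ≤ δ / z * g' y := by
    intro k hk y
    have h1 : r k y = ∑ x, b x / Z x * ∑ Y, if Y k = y then q x Y else 0 := by
      simp only [hr, hlam, Finset.mul_sum]
      rw [Finset.sum_comm]
      refine Finset.sum_congr rfl fun Y _ => ?_
      by_cases h : Y k = y <;> simp [h]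
    have h2 : ∀ x, ∑ Y, (if Y k = y then q x Y else 0) ≤ g' y := by
      intro x
      have h3 := sum_prod_ite_eq_le (w x) (hw0 x) (hw1 x) k y
      have h4 : w x k y = g' y := by simp [hw, hk]
      rw [h4] at h3
      refine le_trans (Finset.sum_le_sum fun Y _ => ?_) h3
      have : 0 ≤ ∏ k, w x k (Y k) := Finset.prod_nonneg fun k _ => hw0 _ _ _
      simp only [hq]
      split_ifs <;> simp [this]
    rw [h1]
    calc _ ≤ ∑ x, b x / z * g' y := by
          refine Finset.sum_le_sum fun x _ => ?_
          have h5 : b x / Z x ≤ b x / z := div_le_div_of_nonneg_left (hb0 x) hz0 (hZz x)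
          exact mul_le_mul h5 (h2 x)
            (Finset.sum_nonneg fun Y _ => by split_ifs <;> simp [hq0])
            (div_nonneg (hb0 x) hz0.le)
      _ = (∑ x, b x) / z * g' y := by rw [← Finset.sum_mul, Finset.sum_div]
      _ ≤ _ := mul_le_mul_of_nonneg_right (div_le_div_of_nonneg_right hδ hz0.le) (hg'0 y)
  set e : (Fin N → L) → ℝ := fun t => ∑ i, ∑ Y, if regroup Y i = t then lam Y else 0 with he
  have he_test : ∀ φ : (Fin N → L) → ℝ, ∑ t, e t * φ t = ∑ i, ∑ Y, lam Y * φ (regroup Y i) := by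
    intro φ
    have h1 : ∀ t, e t * φ t = ∑ i, (∑ Y, if regroup Y i = t then lam Y else 0) * φ t :=
      fun t => Finset.sum_mul _ _ _
    simp_rw [h1]
    rw [Finset.sum_comm]
    exact Finset.sum_congr rfl fun i _ => sum_mul_sum_fiber (fun Y => regroup Y i) lam φ
  refine ⟨fun y => g' y - ∑ k ∈ Finset.univ.erase 0, r k y, e, ?_, ?_, ?_, ?_, ?_, ?_⟩
  · intro y
    have h1 : ∑ k ∈ Finset.univ.erase (0 : Fin N), r k y ≤
        ∑ _k ∈ Finset.univ.erase (0 : Fin N), δ / z * g' y :=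
      Finset.sum_le_sum fun k hk => hrle k (Finset.mem_erase.1 hk).1 y
    rw [Finset.sum_const, Finset.card_erase_of_mem (Finset.mem_univ _), Finset.card_univ,
      Fintype.card_fin, nsmul_eq_mul, Nat.cast_sub NeZero.one_le, Nat.cast_one] at h1
    have h2 : ((N : ℝ) - 1) * (δ / z * g' y) ≤ g' y := by
      have : ((N : ℝ) - 1) * (δ / z * g' y) = ((N : ℝ) - 1) * δ / z * g' y := by ring
      rw [this]
      exact mul_le_of_le_one_left (hg'0 y) ((div_le_one hz0).2 hδz)
    linarith
  · intro t
    refine Finset.sum_nonneg fun i _ => Finset.sum_nonneg fun Y _ => ?_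
    split_ifs <;> simp [hlam0]
  · intro y
    have : 0 ≤ ∑ k ∈ Finset.univ.erase (0 : Fin N), r k y :=
      Finset.sum_nonneg fun k _ => hr0 k y
    change g' y - _ ≤ g' y
    linarith
  · intro t ht j j' hj
    obtain ⟨i, -, hi⟩ := Finset.exists_ne_zero_of_sum_ne_zero ht
    obtain ⟨Y, -, hY⟩ := Finset.exists_ne_zero_of_sum_ne_zero hi
    obtain ⟨rfl, h2⟩ : regroup Y i = t ∧ lam Y ≠ 0 := by
      by_cases h : regroup Y i = t
      · exact ⟨h, by simpa [h] using hY⟩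
      · simp [h] at hY
    have hadm := hlamadm Y h2
    rcases lt_or_gt_of_ne hj with h | h
    · exact hadm i j j' h
    · exact hsymm _ _ (hadm i j' j h)
  · have h1 := he_test fun _ => 1
    have h2 := hrow0 fun _ => 1
    simp only [mul_one] at h1 h2
    rw [h1, h2, Finset.sum_const, Finset.card_univ, Fintype.card_fin, nsmul_eq_mul]
    exact mul_le_mul_of_nonneg_left hδ (Nat.cast_nonneg N)
  · intro j φ
    simp only [add_mul, Finset.sum_add_distrib, sub_mul, Finset.sum_sub_distrib]
    have h1 : ∑ t, e t * φ (t j) = ∑ k, ∑ Y, lam Y * φ (Y k j) := by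
      rw [he_test fun t => φ (t j)]
      exact Fintype.sum_equiv (Equiv.subLeft j) _ _ fun i => rfl
    have h2 : ∑ y, (∑ k ∈ Finset.univ.erase 0, r k y) * φ (y j) =
        ∑ k ∈ Finset.univ.erase 0, ∑ Y, lam Y * φ (Y k j) := by
      have h3 : ∀ y : Fin N → L, (∑ k ∈ Finset.univ.erase 0, r k y) * φ (y j) =
          ∑ k ∈ Finset.univ.erase 0, r k y * φ (y j) := fun y => Finset.sum_mul _ _ _
      simp_rw [h3]
      rw [Finset.sum_comm]
      refine Finset.sum_congr rfl fun k _ => ?_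
      exact sum_mul_sum_fiber (fun Y : Fin N → Fin N → L => Y k) lam (fun y => φ (y j))
    rw [h1, h2, ← Finset.add_sum_erase Finset.univ _ (Finset.mem_univ (0 : Fin N)),
      hrow0 (fun y => φ (y j)), ← hmarg j φ]
    simp only [hsplit, add_mul, Finset.sum_add_distrib]
    ring

open Classical in
/-- Symmetrization of `exists_rearrangement`. -/
theorem exists_symmetric_rearrangement [NeZero N] (sep : L → L → Prop)
    (hsymm : ∀ l l', sep l l' → sep l' l)
    (p : L → ℝ) (g : (Fin N → L) → ℝ) (hg : ∀ k, 0 ≤ g k) (hg1 : ∑ k, g k = 1)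
    (hmarg : ∀ (j : Fin N) (φ : L → ℝ), ∑ k, g k * φ (k j) = ∑ l, p l * φ l)
    (hgσ : ∀ (σ : Equiv.Perm (Fin N)) k, g (k ∘ σ) = g k)
    (Good : (Fin N → L) → Prop) (hGσ : ∀ (σ : Equiv.Perm (Fin N)) k, Good k → Good (k ∘ σ))
    (Fine : L → Prop) (hGF : ∀ k, Good k → ∀ j, Fine (k j))
    {κ δ z : ℝ} (hκ : 0 ≤ κ) (hsep : ∀ l, ∑ l', (if Fine l' ∧ ¬ sep l l' then p l' else 0) ≤ κ)
    (hδ : ∑ k, (if Good k then 0 else g k) ≤ δ) (hδ1 : δ ≤ 1) (hz0 : 0 < z)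
    (hz : z ≤ (1 - δ) ^ (N - 1) - (N : ℝ) ^ 2 * ((N : ℝ) - 1) / 2 * κ)
    (hδz : ((N : ℝ) - 1) * δ ≤ z) :
    ∃ g₀ e : (Fin N → L) → ℝ, (∀ k, 0 ≤ g₀ k) ∧ (∀ k, 0 ≤ e k) ∧
      (∀ k, g₀ k ≤ if Good k then g k else 0) ∧
      (∀ k, e k ≠ 0 → ∀ j j', j ≠ j' → sep (k j) (k j')) ∧ ∑ k, e k ≤ N * δ ∧
      (∀ (j : Fin N) (φ : L → ℝ), ∑ k, (g₀ k + e k) * φ (k j) = ∑ l, p l * φ l) ∧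
      ∀ (σ : Equiv.Perm (Fin N)) k, g₀ (k ∘ σ) = g₀ k ∧ e (k ∘ σ) = e k := by
  obtain ⟨g₀, e, hg₀, he, hle, hes, hem, hmar⟩ := exists_rearrangement sep hsymm p g hg hg1 hmarg
    Good Fine hGF hκ hsep hδ hδ1 hz0 hz hδz
  set n : ℝ := ((Fintype.card (Equiv.Perm (Fin N)) : ℕ) : ℝ) with hn
  have hn0 : 0 < n := by rw [hn]; exact_mod_cast Fintype.card_pos
  have hnc : ∀ c : ℝ, (∑ _σ : Equiv.Perm (Fin N), c) / n = c := by
    intro c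
    rw [Finset.sum_const, Finset.card_univ, nsmul_eq_mul, ← hn]
    field_simp
  have hperm : ∀ (σ : Equiv.Perm (Fin N)) (F : (Fin N → L) → ℝ), ∑ k, F (k ∘ σ) = ∑ k, F k := by
    intro σ F
    exact Fintype.sum_equiv (Equiv.arrowCongr σ.symm (Equiv.refl L)) _ _ fun k => by
      congr 1
  have hinv : ∀ (F : (Fin N → L) → ℝ) (τ : Equiv.Perm (Fin N)) k,
      ∑ σ : Equiv.Perm (Fin N), F ((k ∘ τ) ∘ σ) = ∑ σ : Equiv.Perm (Fin N), F (k ∘ σ) := by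
    intro F τ k
    exact Fintype.sum_equiv (Equiv.mulLeft τ) _ _ fun σ => rfl
  refine ⟨fun k => (∑ σ : Equiv.Perm (Fin N), g₀ (k ∘ σ)) / n,
    fun k => (∑ σ : Equiv.Perm (Fin N), e (k ∘ σ)) / n, ?_, ?_, ?_, ?_, ?_, ?_, ?_⟩
  · exact fun k => div_nonneg (Finset.sum_nonneg fun σ _ => hg₀ _) hn0.le
  · exact fun k => div_nonneg (Finset.sum_nonneg fun σ _ => he _) hn0.le
  · intro k
    rw [← hnc (if Good k then g k else 0)]
    refine div_le_div_of_nonneg_right (Finset.sum_le_sum fun σ _ => ?_) hn0.le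
    have hiff : Good (k ∘ σ) ↔ Good k := by
      refine ⟨fun h => ?_, hGσ σ k⟩
      have := hGσ σ⁻¹ _ h
      rwa [Function.comp_assoc, ← Equiv.Perm.coe_mul, mul_inv_cancel, Equiv.Perm.coe_one,
        Function.comp_id] at this
    have := hle (k ∘ σ)
    simpa only [hiff, hgσ σ k] using this
  · intro k hk j j' hj
    have hk' : ∑ σ : Equiv.Perm (Fin N), e (k ∘ σ) ≠ 0 := fun h => hk (by simp [h])
    obtain ⟨σ, -, hσ⟩ := Finset.exists_ne_zero_of_sum_ne_zero hk'
    have := hes _ hσ (σ⁻¹ j) (σ⁻¹ j') (fun h => hj (σ⁻¹.injective h))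
    simpa using this
  · rw [← Finset.sum_div, Finset.sum_comm]
    simp_rw [hperm]
    rw [hnc]
    exact hem
  · intro j φ
    have h1 : ∀ k : Fin N → L, ((∑ σ : Equiv.Perm (Fin N), g₀ (k ∘ σ)) / n +
        (∑ σ : Equiv.Perm (Fin N), e (k ∘ σ)) / n) * φ (k j) =
        (∑ σ : Equiv.Perm (Fin N), (g₀ (k ∘ σ) + e (k ∘ σ)) * φ ((k ∘ σ) (σ⁻¹ j))) / n := by
      intro k
      have h0 : ∀ σ : Equiv.Perm (Fin N), (k ∘ σ) (σ⁻¹ j) = k j := fun σ => by simp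
      simp_rw [h0]
      rw [← Finset.sum_mul, Finset.sum_add_distrib]
      ring
    simp_rw [h1]
    rw [← Finset.sum_div, Finset.sum_comm]
    have h2 : ∀ σ : Equiv.Perm (Fin N),
        ∑ k : Fin N → L, (g₀ (k ∘ σ) + e (k ∘ σ)) * φ ((k ∘ σ) (σ⁻¹ j)) = ∑ l, p l * φ l := by
      intro σ
      rw [hperm σ (fun k => (g₀ k + e k) * φ (k (σ⁻¹ j)))]
      exact hmar _ _
    simp_rw [h2]
    rw [hnc]
  · intro τ k
    constructor
    · simp only []
      rw [hinv g₀ τ k]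
    · simp only []
      rw [hinv e τ k]

end Discrete

/-! ### The compensated cost -/

/-- If `g + H = G ≥ 0` with `∫ H < ∞`, then the extended integral of `g` is `∫ G - ∫ H`. -/
theorem extIntegral_eq_sub {Y : Type*} [MeasurableSpace Y] {μ : Measure Y} {g : Y → EReal}
    {G H : Y → ℝ≥0∞} (hg : Measurable g) (hH : Measurable H) (hfin : ∫⁻ y, H y ∂μ ≠ ⊤)
    (hHtop : ∀ y, H y ≠ ⊤) (heq : ∀ y, g y + H y = G y) :
    extIntegral μ g = ((∫⁻ y, G y ∂μ : ℝ≥0∞) : EReal) - ((∫⁻ y, H y ∂μ : ℝ≥0∞) : EReal) := by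
  have hpt : ∀ y, (g y).toENNReal + H y = G y + (-g y).toENNReal ∧ (-g y).toENNReal ≤ H y := by
    intro y
    have h := heq y
    lift H y to NNReal using hHtop y with c
    revert h
    induction g y using EReal.rec with
    | bot =>
      intro h
      rw [EReal.bot_add] at h
      exact absurd h.symm (EReal.coe_ennreal_ne_bot _)
    | top =>
      intro h
      have : (⊤ : EReal) + ((c : ℝ≥0∞) : EReal) = ⊤ := EReal.top_add_of_ne_bot (by simp)
      rw [this] at h
      have h2 : G y = ⊤ := by simpa using h.symm
      simp [h2]
    | coe r =>
      intro h
      have hsum : (r : EReal) + ((c : ℝ≥0∞) : EReal) = ((r + (c : ℝ) : ℝ) : EReal) := by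
        rw [EReal.coe_add]; rfl
      rw [hsum] at h
      have h0 : 0 ≤ r + (c : ℝ) := by
        have : (0 : EReal) ≤ ((r + (c : ℝ) : ℝ) : EReal) := h ▸ EReal.coe_ennreal_nonneg _
        exact_mod_cast this
      have h2 : G y = ENNReal.ofReal (r + (c : ℝ)) := by
        have : ((G y : ℝ≥0∞) : EReal).toENNReal = ((r + (c : ℝ) : ℝ) : EReal).toENNReal := by rw [h]
        rwa [EReal.toENNReal_coe, EReal.real_coe_toENNReal] at this
      have hc : (c : ℝ≥0∞) = ENNReal.ofReal (c : ℝ) := (ENNReal.ofReal_coe_nnreal).symm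
      rw [h2, ← EReal.coe_neg, EReal.real_coe_toENNReal, EReal.real_coe_toENNReal, hc]
      constructor
      · rcases le_total 0 r with hr | hr
        · rw [ENNReal.ofReal_of_nonpos (neg_nonpos.2 hr), add_zero,
            ENNReal.ofReal_add hr c.coe_nonneg]
        · rw [ENNReal.ofReal_of_nonpos hr, zero_add, ← ENNReal.ofReal_add h0 (neg_nonneg.2 hr)]
          congr 1; ring
      · exact ENNReal.ofReal_le_ofReal (by linarith)
  have hneg : ∫⁻ y, (-g y).toENNReal ∂μ ≠ ⊤ :=
    ((lintegral_mono fun y => (hpt y).2).trans_lt hfin.lt_top).ne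
  have hint : ∫⁻ y, (g y).toENNReal ∂μ + ∫⁻ y, H y ∂μ =
      ∫⁻ y, G y ∂μ + ∫⁻ y, (-g y).toENNReal ∂μ := by
    have hm : Measurable fun y => (-g y).toENNReal := hg.neg.ereal_toENNReal
    rw [← lintegral_add_right _ hH, ← lintegral_add_right _ hm]
    exact lintegral_congr fun y => (hpt y).1
  unfold extIntegral
  have hH' := hfin
  revert hint hneg hfin
  generalize ∫⁻ y, (g y).toENNReal ∂μ = a
  generalize ∫⁻ y, H y ∂μ = b
  generalize ∫⁻ y, G y ∂μ = c
  generalize ∫⁻ y, (-g y).toENNReal ∂μ = d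
  intro hb hd hint
  lift b to NNReal using hb
  lift d to NNReal using hd
  induction a using ENNReal.recTopCoe with
  | top =>
    rw [top_add] at hint
    have : c = ⊤ := by
      by_contra h
      exact ENNReal.add_ne_top.2 ⟨h, ENNReal.coe_ne_top⟩ hint.symm
    rw [this]
    change (⊤ : EReal) - ((d : ℝ) : EReal) = ⊤ - ((b : ℝ) : EReal)
    rw [EReal.top_sub_coe, EReal.top_sub_coe]
  | coe a =>
    induction c using ENNReal.recTopCoe with
    | top =>
      rw [top_add] at hint
      exact absurd hint (ENNReal.add_ne_top.2 ⟨ENNReal.coe_ne_top, ENNReal.coe_ne_top⟩)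
    | coe c =>
      have h1 : a + b = c + d := by exact_mod_cast hint
      have h2 : (a : ℝ) + b = c + d := by exact_mod_cast h1
      change ((a : ℝ) : EReal) - ((d : ℝ) : EReal) = ((c : ℝ) : EReal) - ((b : ℝ) : EReal)
      rw [← EReal.coe_sub, ← EReal.coe_sub, EReal.coe_eq_coe_iff]
      linarith

/-- The negative part of the interaction, `max 0 (-f t)`, extended by `0` to `t ≤ 0`. -/
def negTail (f : ℝ → ℝ) (t : ℝ) : ℝ := if t ≤ 0 then 0 else max 0 (-f t)

theorem negTail_nonneg (f : ℝ → ℝ) (t : ℝ) : 0 ≤ negTail f t := by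
  unfold negTail; split_ifs
  · exact le_rfl
  · exact le_max_left _ _

section Interaction

variable {f : ℝ → ℝ} (hf : IsRepulsive f)
include hf

theorem IsRepulsive.exists_forall_le (M : ℝ) : ∃ t₀ > 0, ∀ t, 0 < t → t ≤ t₀ → M ≤ f t := by
  have h := hf.tendsto_zero.eventually_ge_atTop M
  rw [eventually_nhdsWithin_iff, Metric.eventually_nhds_iff] at h
  obtain ⟨ε, hε, h⟩ := h
  refine ⟨ε / 2, by positivity, fun t ht hle => h ?_ ht⟩
  rw [Real.dist_eq, sub_zero, abs_of_pos ht]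
  linarith

theorem IsRepulsive.monotone_negTail : Monotone (negTail f) := by
  intro s t hst
  unfold negTail
  split_ifs with h1 h2 h2
  · exact le_rfl
  · exact le_max_left _ _
  · linarith
  · exact max_le_max le_rfl (neg_le_neg (hf.antitoneOn (not_le.1 h1) (not_le.1 h2) hst))

theorem IsRepulsive.continuous_negTail : Continuous (negTail f) := by
  rw [continuous_iff_continuousAt]
  intro t
  rcases lt_or_ge 0 t with ht | ht
  · have hc : ContinuousAt (fun s => max 0 (-f s)) t :=
      continuousAt_const.max ((hf.continuousOn.continuousAt (Ioi_mem_nhds ht)).neg)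
    refine hc.congr ?_
    filter_upwards [Ioi_mem_nhds ht] with s hs
    simp [negTail, not_le.2 (Set.mem_Ioi.1 hs)]
  · obtain ⟨t₀, ht₀, h⟩ := hf.exists_forall_le 0
    refine (continuousAt_const (y := (0 : ℝ))).congr ?_
    filter_upwards [Iio_mem_nhds (ht.trans_lt ht₀)] with s hs
    unfold negTail
    split_ifs with h1
    · rfl
    · exact (max_eq_left (neg_nonpos.2 (h s (not_le.1 h1) (le_of_lt hs)))).symm

end Interaction

section

variable {X : Type*} [MetricSpace X] {N : ℕ}

/-- The weight `h(x) = max(0, -f(2 d(x, o)))` that compensates the negative part of the cost. -/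
def tailWeight (f : ℝ → ℝ) (o x : X) : ℝ := negTail f (2 * dist x o)

/-- The compensated pair interaction `f(d(x, y)) + h(x) + h(y)`, which is nonnegative. -/
def compPair (f : ℝ → ℝ) (o x y : X) : ℝ≥0∞ :=
  if dist x y = 0 then ⊤
  else ENNReal.ofReal (f (dist x y) + tailWeight f o x + tailWeight f o y)

/-- The compensated cost: the sum of `f(d(x_i, x_j)) + h(x_i) + h(x_j)` over the pairs `i < j`. -/
def compCost (f : ℝ → ℝ) (o : X) (x : Fin N → X) : ℝ≥0∞ :=
  ∑ p : Fin N × Fin N with p.1 < p.2, compPair f o (x p.1) (x p.2)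

/-- The sum of `h(x_i) + h(x_j)` over the pairs `i < j`. -/
def compensation (f : ℝ → ℝ) (o : X) (x : Fin N → X) : ℝ≥0∞ :=
  ∑ p : Fin N × Fin N with p.1 < p.2,
    (ENNReal.ofReal (tailWeight f o (x p.1)) + ENNReal.ofReal (tailWeight f o (x p.2)))

variable {f : ℝ → ℝ} (hf : IsRepulsive f) (o : X)
include hf

theorem IsRepulsive.continuous_tailWeight : Continuous (tailWeight f o) :=
  hf.continuous_negTail.comp (by fun_prop)

/-- As `d(x, y) ≤ 2 max (d(x, o), d(y, o))` and `f` decreases, the weight of the point farther from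
`o` compensates `f(d(x, y))`. -/
theorem IsRepulsive.add_tailWeight_nonneg {x y : X} (hxy : dist x y ≠ 0) :
    0 ≤ f (dist x y) + tailWeight f o x + tailWeight f o y := by
  have hpos : 0 < dist x y := lt_of_le_of_ne dist_nonneg (Ne.symm hxy)
  have htri : dist x y ≤ dist x o + dist y o := by
    have := dist_triangle x o y; rwa [dist_comm o y] at this
  have key : ∀ z : X, dist x y ≤ 2 * dist z o → -f (dist x y) ≤ tailWeight f o z := by
    intro z hz
    have h2 : 0 < 2 * dist z o := hpos.trans_le hz
    have h3 := hf.antitoneOn (Set.mem_Ioi.2 hpos) (Set.mem_Ioi.2 h2) hz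
    unfold tailWeight negTail
    rw [if_neg (not_le.2 h2)]
    exact (neg_le_neg h3).trans (le_max_right _ _)
  have hx := negTail_nonneg f (2 * dist x o)
  have hy := negTail_nonneg f (2 * dist y o)
  change 0 ≤ tailWeight f o x at hx
  change 0 ≤ tailWeight f o y at hy
  rcases le_total (dist x o) (dist y o) with h | h
  · have := key y (by linarith)
    linarith
  · have := key x (by linarith)
    linarith

theorem IsRepulsive.continuous_compPair : Continuous fun q : X × X => compPair f o q.1 q.2 := by
  rw [continuous_iff_continuousAt]
  rintro ⟨x, y⟩
  have hd : Continuous fun q : X × X => dist q.1 q.2 := by fun_prop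
  have hw := hf.continuous_tailWeight o
  by_cases hxy : dist x y = 0
  · have hval : compPair f o x y = ⊤ := if_pos hxy
    unfold ContinuousAt
    simp only [hval]
    rw [ENNReal.tendsto_nhds_top_iff_nnreal]
    intro M
    obtain ⟨t₀, ht₀, h⟩ := hf.exists_forall_le (M + 1)
    have : ∀ᶠ q : X × X in 𝓝 (x, y), dist q.1 q.2 < t₀ :=
      hd.continuousAt.eventually_lt continuousAt_const (by simpa [hxy] using ht₀)
    filter_upwards [this] with q hq
    unfold compPair
    split_ifs with h0
    · exact ENNReal.coe_lt_top
    · have h1 := h _ (lt_of_le_of_ne dist_nonneg (Ne.symm h0)) hq.le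
      have hx := negTail_nonneg f (2 * dist q.1 o)
      have hy := negTail_nonneg f (2 * dist q.2 o)
      rw [← ENNReal.ofReal_coe_nnreal, ENNReal.ofReal_lt_ofReal_iff_of_nonneg M.coe_nonneg]
      unfold tailWeight
      linarith
  · have hpos : 0 < dist x y := lt_of_le_of_ne dist_nonneg (Ne.symm hxy)
    have hfc : ContinuousAt (fun q : X × X => f (dist q.1 q.2)) (x, y) :=
      ContinuousAt.comp (f := fun q : X × X => dist q.1 q.2) (g := f)
        (hf.continuousOn.continuousAt (Ioi_mem_nhds hpos)) hd.continuousAt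
    have hc : ContinuousAt (fun q : X × X =>
        ENNReal.ofReal (f (dist q.1 q.2) + tailWeight f o q.1 + tailWeight f o q.2)) (x, y) :=
      ENNReal.continuous_ofReal.continuousAt.comp
        ((hfc.add (hw.comp continuous_fst).continuousAt).add (hw.comp continuous_snd).continuousAt)
    refine hc.congr ?_
    filter_upwards [hd.continuousAt.eventually_ne hxy] with q hq
    simp [compPair, hq]

theorem IsRepulsive.continuous_compCost : Continuous (compCost f o : (Fin N → X) → ℝ≥0∞) := by
  unfold compCost
  refine continuous_finsetSum _ fun p _ => ?_
  exact (hf.continuous_compPair o).comp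
    (f := fun x : Fin N → X => (x p.1, x p.2)) (by fun_prop)

omit hf in
theorem coe_ennreal_finsetSum {ι : Type*} (s : Finset ι) (F : ι → ℝ≥0∞) :
    ((∑ i ∈ s, F i : ℝ≥0∞) : EReal) = ∑ i ∈ s, (F i : EReal) := by
  classical
  induction s using Finset.induction_on with
  | empty => simp
  | insert a s ha ih => rw [Finset.sum_insert ha, Finset.sum_insert ha, EReal.coe_ennreal_add, ih]

theorem IsRepulsive.cost_add_compensation (x : Fin N → X) :
    cost f x + (compensation f o x : EReal) = (compCost f o x : EReal) := by
  unfold cost compensation compCost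
  rw [coe_ennreal_finsetSum, coe_ennreal_finsetSum, ← Finset.sum_add_distrib]
  refine Finset.sum_congr rfl fun p _ => ?_
  have hx : 0 ≤ tailWeight f o (x p.1) := negTail_nonneg _ _
  have hy : 0 ≤ tailWeight f o (x p.2) := negTail_nonneg _ _
  unfold pairCost compPair
  rw [← ENNReal.ofReal_add hx hy, EReal.coe_ennreal_ofReal, max_eq_left (add_nonneg hx hy)]
  split_ifs with h
  · rw [EReal.top_add_coe]; rfl
  · rw [EReal.coe_ennreal_ofReal, max_eq_left (hf.add_tailWeight_nonneg o h), ← EReal.coe_add,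
      add_assoc]

omit hf in
theorem compensation_ne_top (x : Fin N → X) : compensation f o x ≠ ⊤ :=
  ENNReal.sum_ne_top.2 fun _ _ => ENNReal.add_ne_top.2 ⟨ENNReal.ofReal_ne_top, ENNReal.ofReal_ne_top⟩

variable [MeasurableSpace X] [BorelSpace X]

theorem IsRepulsive.measurable_tailWeight :
    Measurable fun x : X => ENNReal.ofReal (tailWeight f o x) :=
  (hf.continuous_tailWeight o).measurable.ennreal_ofReal

theorem IsRepulsive.measurable_compensation :
    Measurable (compensation f o : (Fin N → X) → ℝ≥0∞) := by
  unfold compensation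
  refine Finset.measurable_fun_sum _ fun p _ => ?_
  exact ((hf.measurable_tailWeight o).comp (measurable_pi_apply _)).add
    ((hf.measurable_tailWeight o).comp (measurable_pi_apply _))

omit hf [MetricSpace X] [BorelSpace X] in
theorem IsCoupling.lintegral_eval {μ : Measure X} {γ : ProbabilityMeasure (Fin N → X)}
    (hγ : IsCoupling μ γ) (i : Fin N) {φ : X → ℝ≥0∞} (hφ : Measurable φ) :
    ∫⁻ x, φ (x i) ∂(γ : Measure (Fin N → X)) = ∫⁻ x, φ x ∂μ := by
  rw [← hγ i, lintegral_map hφ (measurable_pi_apply _)]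

/-- `∫ ∑_{i < j} (h(x_i) + h(x_j)) dγ` for any coupling `γ` of `μ`. -/
def compensationConst (N : ℕ) (f : ℝ → ℝ) (o : X) (μ : Measure X) : ℝ≥0∞ :=
  ∑ p : Fin N × Fin N with p.1 < p.2,
    (∫⁻ x, ENNReal.ofReal (tailWeight f o x) ∂μ + ∫⁻ x, ENNReal.ofReal (tailWeight f o x) ∂μ)

theorem IsRepulsive.lintegral_compensation {μ : Measure X} {γ : ProbabilityMeasure (Fin N → X)}
    (hγ : IsCoupling μ γ) :
    ∫⁻ x, compensation f o x ∂(γ : Measure (Fin N → X)) = compensationConst N f o μ := by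
  have hm := hf.measurable_tailWeight o
  unfold compensation compensationConst
  rw [lintegral_finsetSum]
  · refine Finset.sum_congr rfl fun p _ => ?_
    rw [lintegral_add_left (f := fun x : Fin N → X => ENNReal.ofReal (tailWeight f o (x p.1)))
      (hm.comp (measurable_pi_apply _)), hγ.lintegral_eval p.1 hm, hγ.lintegral_eval p.2 hm]
  · intro p _
    exact (hm.comp (measurable_pi_apply _)).add (hm.comp (measurable_pi_apply _))

/-- On the couplings of `μ`, the transport cost and the integral of the compensated cost differ by a
finite constant. -/
theorem IsRepulsive.transportCost_eq [SecondCountableTopology X] {μ : Measure X}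
    (hμ : ∫⁻ x, ENNReal.ofReal (tailWeight f o x) ∂μ ≠ ⊤) {γ : ProbabilityMeasure (Fin N → X)}
    (hγ : IsCoupling μ γ) :
    transportCost f γ = ((∫⁻ x, compCost f o x ∂(γ : Measure (Fin N → X)) : ℝ≥0∞) : EReal) -
      (compensationConst N f o μ : EReal) := by
  unfold transportCost
  have hcost : (cost f : (Fin N → X) → EReal) =
      fun x => (compCost f o x : EReal) - (compensation f o x : EReal) := by
    funext x
    rw [← hf.cost_add_compensation o x]
    lift compensation f o x to NNReal using compensation_ne_top o x with c
    change _ = cost f x + ((c : ℝ) : EReal) - ((c : ℝ) : EReal)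
    rw [EReal.add_sub_cancel_right]
  have hmeas : Measurable (cost f : (Fin N → X) → EReal) := by
    rw [hcost]
    exact (hf.continuous_compCost o).measurable.coe_ereal_ennreal.sub
      (hf.measurable_compensation o).coe_ereal_ennreal
  rw [extIntegral_eq_sub hmeas (hf.measurable_compensation o) ?_ (compensation_ne_top o)
    (hf.cost_add_compensation o), hf.lintegral_compensation o hγ]
  rw [hf.lintegral_compensation o hγ]
  exact ENNReal.sum_ne_top.2 fun _ _ => ENNReal.add_ne_top.2 ⟨hμ, hμ⟩

omit o in
/-- Condition (B) makes the weight `h` integrable: near `o` it is bounded because it increases with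
the distance to `o`. -/
theorem IsRepulsive.exists_lintegral_tailWeight_ne_top {μ : Measure X} [IsFiniteMeasure μ]
    (hB : ConditionB f μ) : ∃ o : X, ∫⁻ x, ENNReal.ofReal (tailWeight f o x) ∂μ ≠ ⊤ := by
  obtain ⟨o, r₀, hr₀, h⟩ := hB
  refine ⟨o, ?_⟩
  have hneg : ∫⁻ x in (Metric.ball o r₀)ᶜ, (-pairCost f (2 * dist x o)).toENNReal ∂μ ≠ ⊤ := by
    intro htop
    unfold extIntegral at h
    rw [htop] at h
    simp at h
  rw [← lintegral_add_compl _ (measurableSet_ball (x := o) (ε := r₀))]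
  refine ENNReal.add_ne_top.2 ⟨?_, ?_⟩
  · refine ((setLIntegral_mono' (g := fun _ => ENNReal.ofReal (negTail f (2 * r₀)))
      measurableSet_ball fun x hx => ?_).trans_lt ?_).ne
    · refine ENNReal.ofReal_le_ofReal (hf.monotone_negTail ?_)
      have := Metric.mem_ball.1 hx
      linarith
    · rw [setLIntegral_const]
      exact ENNReal.mul_lt_top ENNReal.ofReal_lt_top (measure_lt_top _ _)
  · refine ((setLIntegral_mono' measurableSet_ball.compl fun x hx => ?_).trans_lt hneg.lt_top).ne
    have hx' : r₀ ≤ dist x o := by simpa using hx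
    have h2 : 0 < 2 * dist x o := by linarith
    unfold pairCost tailWeight negTail
    rw [if_neg h2.ne', if_neg (not_le.2 h2), ← EReal.coe_neg, EReal.real_coe_toENNReal]
    rcases le_total 0 (-f (2 * dist x o)) with h3 | h3
    · rw [max_eq_right h3]
    · rw [max_eq_left h3]; simp

end

/-! ### Entropy of couplings -/

section

variable {X : Type*} [MeasurableSpace X]

/-- Tonelli's theorem for a product of functions of one coordinate. -/
theorem lintegral_fin_prod_eq_prod {n : ℕ} (m : Fin n → Measure X) [∀ i, SigmaFinite (m i)]
    {φ : Fin n → X → ℝ≥0∞} (hφ : ∀ i, Measurable (φ i)) :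
    ∫⁻ x : Fin n → X, ∏ i, φ i (x i) ∂(Measure.pi m) = ∏ i, ∫⁻ x, φ i x ∂(m i) := by
  induction n with
  | zero => simp
  | succ n ih =>
    rw [← ((measurePreserving_piFinSuccAbove m 0).symm).lintegral_comp_emb
      (MeasurableEquiv.measurableEmbedding _)]
    simp_rw [MeasurableEquiv.piFinSuccAbove_symm_apply, Fin.insertNthEquiv, Fin.prod_univ_succ,
      Fin.insertNth_zero, Equiv.coe_fn_mk, Fin.cons_succ, Fin.zero_succAbove, Fin.cons_zero]
    rw [← ih (fun i => m i.succ) (fun i => hφ i.succ),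
      ← lintegral_prod_mul (hφ 0).aemeasurable (Finset.measurable_fun_prod _ fun i _ =>
        (hφ i.succ).comp (measurable_pi_apply i)).aemeasurable]
    rfl

variable {N : ℕ}

/-- The density of `(ρ m)^{⊗ N}` with respect to `m^{⊗ N}`. -/
def productDensity (ρ : X → ℝ) (x : Fin N → X) : ℝ≥0∞ := ∏ i, ENNReal.ofReal (ρ (x i))

variable {m : Measure X} [SigmaFinite m] {ρ : X → ℝ} (hρ : Measurable ρ)
include hρ

omit [SigmaFinite m] m in
theorem measurable_productDensity : Measurable (productDensity ρ : (Fin N → X) → ℝ≥0∞) :=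
  Finset.measurable_fun_prod _ fun i _ => (hρ.comp (measurable_pi_apply i)).ennreal_ofReal

theorem pi_densityMeasure [SigmaFinite (densityMeasure m ρ)] :
    Measure.pi (fun _ : Fin N => densityMeasure m ρ) =
      (Measure.pi fun _ : Fin N => m).withDensity (productDensity ρ) := by
  refine Measure.pi_eq fun s hs => ?_
  rw [withDensity_apply _ (MeasurableSet.univ_pi hs), ← lintegral_indicator (MeasurableSet.univ_pi hs)]
  have h1 : (Set.univ.pi s).indicator (productDensity ρ) =
      fun x : Fin N → X => ∏ i, (s i).indicator (fun y => ENNReal.ofReal (ρ y)) (x i) := by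
    funext x
    by_cases hx : x ∈ Set.univ.pi s
    · rw [Set.indicator_of_mem hx]
      exact Finset.prod_congr rfl fun i _ => (Set.indicator_of_mem (hx i trivial) (fun y => ENNReal.ofReal (ρ y))).symm
    · rw [Set.indicator_of_notMem hx]
      simp only [Set.mem_pi, Set.mem_univ, true_implies, not_forall] at hx
      obtain ⟨i, hi⟩ := hx
      exact (Finset.prod_eq_zero (Finset.mem_univ i) (Set.indicator_of_notMem hi _)).symm
  rw [h1, lintegral_fin_prod_eq_prod (fun _ => m) fun i => hρ.ennreal_ofReal.indicator (hs i)]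
  refine Finset.prod_congr rfl fun i _ => ?_
  rw [lintegral_indicator (hs i), densityMeasure, withDensity_apply _ (hs i)]

theorem lintegral_productDensity [IsProbabilityMeasure (densityMeasure m ρ)] :
    ∫⁻ x : Fin N → X, productDensity ρ x ∂(Measure.pi fun _ => m) = 1 := by
  rw [← setLIntegral_univ, ← withDensity_apply _ MeasurableSet.univ, ← pi_densityMeasure hρ]
  exact measure_univ

omit [SigmaFinite m] in
/-- The integrability of `ρ log ρ`, as a bound for `∫ |log ρ| dμ` with `μ = ρ m`. -/
theorem lintegral_abs_log_ne_top (hρ0 : ∀ x, 0 ≤ ρ x)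
    (hlog : Integrable (fun x => ρ x * Real.log (ρ x)) m) :
    ∫⁻ x, ENNReal.ofReal |Real.log (ρ x)| ∂(densityMeasure m ρ) ≠ ⊤ := by
  rw [densityMeasure, lintegral_withDensity_eq_lintegral_mul _ hρ.ennreal_ofReal
    (by fun_prop)]
  have h := hlog.abs.lintegral_lt_top
  refine (lt_of_le_of_lt (lintegral_mono fun x => ?_) h).ne
  simp only [Pi.mul_apply]
  rw [← ENNReal.ofReal_mul (hρ0 x), abs_mul, abs_of_nonneg (hρ0 x)]

omit [SigmaFinite m] in
theorem IsCoupling.ae_pos {γ : ProbabilityMeasure (Fin N → X)}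
    (hγ : IsCoupling (densityMeasure m ρ) γ) :
    ∀ᵐ x ∂(γ : Measure (Fin N → X)), ∀ i, 0 < ρ (x i) := by
  rw [ae_all_iff]
  intro i
  have h1 : ∀ᵐ y ∂(densityMeasure m ρ), 0 < ρ y := by
    rw [densityMeasure, ae_withDensity_iff hρ.ennreal_ofReal]
    refine Eventually.of_forall fun y hy => ?_
    by_contra hn
    exact hy (ENNReal.ofReal_of_nonpos (not_lt.1 hn))
  rw [← hγ i] at h1
  exact ae_of_ae_map (measurable_pi_apply i).aemeasurable h1

omit [SigmaFinite m] in
theorem IsCoupling.lintegral_sum_abs_log {γ : ProbabilityMeasure (Fin N → X)}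
    (hγ : IsCoupling (densityMeasure m ρ) γ) :
    ∫⁻ x, ∑ i, ENNReal.ofReal |Real.log (ρ (x i))| ∂(γ : Measure (Fin N → X)) =
      N * ∫⁻ x, ENNReal.ofReal |Real.log (ρ x)| ∂(densityMeasure m ρ) := by
  have hm : Measurable fun x => ENNReal.ofReal |Real.log (ρ x)| := by fun_prop
  rw [lintegral_finsetSum (f := fun (i : Fin N) (x : Fin N → X) =>
    ENNReal.ofReal |Real.log (ρ (x i))|) _ fun i _ => hm.comp (measurable_pi_apply i)]
  rw [Finset.sum_congr rfl fun i _ => hγ.lintegral_eval i hm, Finset.sum_const, Finset.card_univ,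
    Fintype.card_fin, nsmul_eq_mul]

/-- Almost everywhere, the density of a coupling is finite, and it vanishes wherever one of the
factors `ρ (x i)` does. -/
theorem IsCoupling.ae_rnDeriv {γ : ProbabilityMeasure (Fin N → X)}
    (hγ : IsCoupling (densityMeasure m ρ) γ)
    (hac : (γ : Measure (Fin N → X)) ≪ Measure.pi fun _ => m) :
    ∀ᵐ x ∂(Measure.pi fun _ : Fin N => m),
      (γ : Measure (Fin N → X)).rnDeriv (Measure.pi fun _ => m) x < ⊤ ∧
      ((γ : Measure (Fin N → X)).rnDeriv (Measure.pi fun _ => m) x ≠ 0 → ∀ i, 0 < ρ (x i)) := by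
  have h1 := hγ.ae_pos hρ
  rw [← Measure.withDensity_rnDeriv_eq _ _ hac,
    ae_withDensity_iff (Measure.measurable_rnDeriv _ _)] at h1
  filter_upwards [h1, Measure.rnDeriv_lt_top (γ : Measure (Fin N → X)) (Measure.pi fun _ => m)]
    with x hx hx' using ⟨hx', hx⟩

omit hρ in
theorem lintegral_rnDeriv_mul_eq {γ : ProbabilityMeasure (Fin N → X)}
    (hac : (γ : Measure (Fin N → X)) ≪ Measure.pi fun _ => m) {F : (Fin N → X) → ℝ≥0∞}
    (hF : Measurable F) :
    ∫⁻ x, (γ : Measure (Fin N → X)).rnDeriv (Measure.pi fun _ => m) x * F x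
      ∂(Measure.pi fun _ => m) = ∫⁻ x, F x ∂(γ : Measure (Fin N → X)) := by
  conv_rhs => rw [← Measure.withDensity_rnDeriv_eq _ _ hac]
  rw [lintegral_withDensity_eq_lintegral_mul _ (Measure.measurable_rnDeriv _ _) hF]
  rfl

/-- The entropy of a coupling is bounded below in terms of `∫ ρ |log ρ| dm` only: with
`R = ∏ ρ (x i)`, the inequality `log t ≥ 1 - 1 / t` gives `g log g ≥ g log R - R`. -/
theorem IsCoupling.le_entropy [IsProbabilityMeasure (densityMeasure m ρ)]
    {γ : ProbabilityMeasure (Fin N → X)} (hγ : IsCoupling (densityMeasure m ρ) γ) :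
    -((1 + N * ∫⁻ x, ENNReal.ofReal |Real.log (ρ x)| ∂(densityMeasure m ρ) : ℝ≥0∞) : EReal) ≤
      entropy m γ := by
  unfold entropy
  split_ifs with hac
  swap
  · exact le_top
  have hm : Measurable fun x => ENNReal.ofReal |Real.log (ρ x)| := by fun_prop
  have hms : Measurable fun x : Fin N → X => ∑ i, ENNReal.ofReal |Real.log (ρ (x i))| :=
    Finset.measurable_fun_sum _ fun i _ => hm.comp (measurable_pi_apply i)
  set g := (γ : Measure (Fin N → X)).rnDeriv (Measure.pi fun _ => m) with hg
  have hneg : ∫⁻ x, (-(((g x).toReal * Real.log (g x).toReal : ℝ) : EReal)).toENNReal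
      ∂(Measure.pi fun _ => m) ≤
      1 + N * ∫⁻ x, ENNReal.ofReal |Real.log (ρ x)| ∂(densityMeasure m ρ) := by
    rw [← lintegral_productDensity (N := N) (m := m) hρ, ← hγ.lintegral_sum_abs_log hρ,
      ← lintegral_rnDeriv_mul_eq hac hms, ← lintegral_add_left (measurable_productDensity hρ)]
    refine lintegral_mono_ae ?_
    filter_upwards [hγ.ae_rnDeriv hρ hac] with x hx
    rw [← hg] at hx ⊢
    rw [← EReal.coe_neg, EReal.real_coe_toENNReal]
    by_cases h0 : g x = 0
    · simp [h0]
    have hpos := hx.2 h0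
    have hgr : 0 < (g x).toReal := ENNReal.toReal_pos h0 hx.1.ne
    have hR : 0 < ∏ i, ρ (x i) := Finset.prod_pos fun i _ => hpos i
    have hge : g x = ENNReal.ofReal (g x).toReal := (ENNReal.ofReal_toReal hx.1.ne).symm
    have hpd : productDensity ρ x = ENNReal.ofReal (∏ i, ρ (x i)) :=
      (ENNReal.ofReal_prod_of_nonneg fun i _ => (hpos i).le).symm
    rw [hpd, ← ENNReal.ofReal_sum_of_nonneg fun i _ => abs_nonneg _]
    conv_rhs => rw [hge]
    rw [← ENNReal.ofReal_mul hgr.le, ← ENNReal.ofReal_add hR.le (mul_nonneg hgr.le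
      (Finset.sum_nonneg fun i _ => abs_nonneg _))]
    refine ENNReal.ofReal_le_ofReal ?_
    have h1 := Real.one_sub_inv_le_log_of_pos (div_pos hgr hR)
    rw [Real.log_div hgr.ne' hR.ne', Real.log_prod (fun i _ => (hpos i).ne')] at h1
    have h2 : -∑ i, Real.log (ρ (x i)) ≤ ∑ i, |Real.log (ρ (x i))| := by
      rw [← Finset.sum_neg_distrib]
      exact Finset.sum_le_sum fun i _ => neg_le_abs _
    have h3 := mul_le_mul_of_nonneg_left h1 hgr.le
    have h4 := mul_le_mul_of_nonneg_left h2 hgr.le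
    have h5 : (g x).toReal * (1 - ((g x).toReal / ∏ i, ρ (x i))⁻¹) =
        (g x).toReal - ∏ i, ρ (x i) := by
      field_simp
    rw [h5] at h3
    linarith
  unfold extIntegral
  refine le_trans (EReal.neg_le_neg_iff.2 (EReal.coe_ennreal_le_coe_ennreal_iff.2 hneg)) ?_
  rw [sub_eq_add_neg]
  exact le_add_of_nonneg_left (EReal.coe_ennreal_nonneg _)

/-- A coupling with a bounded density with respect to `μ^{⊗ N}` has finite entropy. -/
theorem IsCoupling.entropy_lt_top [IsProbabilityMeasure (densityMeasure m ρ)]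
    (hρ0 : ∀ x, 0 ≤ ρ x) (hlog : Integrable (fun x => ρ x * Real.log (ρ x)) m)
    {γ : ProbabilityMeasure (Fin N → X)} (hγ : IsCoupling (densityMeasure m ρ) γ) {C : ℝ}
    (hC : 0 < C) (hle : (γ : Measure (Fin N → X)) ≤
      ENNReal.ofReal C • Measure.pi fun _ => densityMeasure m ρ) :
    entropy m γ < ⊤ := by
  rw [pi_densityMeasure hρ, ← withDensity_smul _ (measurable_productDensity hρ)] at hle
  have hac : (γ : Measure (Fin N → X)) ≪ Measure.pi fun _ => m :=
    (Measure.absolutelyContinuous_of_le hle).trans (withDensity_absolutelyContinuous _ _)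
  unfold entropy
  rw [if_pos hac]
  have hm : Measurable fun x => ENNReal.ofReal |Real.log (ρ x)| := by fun_prop
  have hms : Measurable fun x : Fin N → X =>
      ENNReal.ofReal |Real.log C| + ∑ i, ENNReal.ofReal |Real.log (ρ (x i))| :=
    measurable_const.add (Finset.measurable_fun_sum _ fun i _ => hm.comp (measurable_pi_apply i))
  set g := (γ : Measure (Fin N → X)).rnDeriv (Measure.pi fun _ => m) with hg
  have hgle : g ≤ᵐ[Measure.pi fun _ => m] ENNReal.ofReal C • productDensity ρ := by
    refine ae_le_of_forall_setLIntegral_le_of_sigmaFinite (Measure.measurable_rnDeriv _ _)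
      fun s hs _ => ?_
    rw [← withDensity_apply _ hs, ← withDensity_apply _ hs, hg,
      Measure.withDensity_rnDeriv_eq _ _ hac]
    exact hle s
  have hpos : ∫⁻ x, (((g x).toReal * Real.log (g x).toReal : ℝ) : EReal).toENNReal
      ∂(Measure.pi fun _ => m) < ⊤ := by
    calc _ ≤ ∫⁻ x, g x * (ENNReal.ofReal |Real.log C| +
          ∑ i, ENNReal.ofReal |Real.log (ρ (x i))|) ∂(Measure.pi fun _ => m) := by
          refine lintegral_mono_ae ?_
          filter_upwards [hγ.ae_rnDeriv hρ hac, hgle] with x hx hxle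
          rw [← hg] at hx
          rw [EReal.real_coe_toENNReal]
          by_cases h0 : g x = 0
          · simp [h0]
          have hpos := hx.2 h0
          have hgr : 0 < (g x).toReal := ENNReal.toReal_pos h0 hx.1.ne
          have hR : 0 < ∏ i, ρ (x i) := Finset.prod_pos fun i _ => hpos i
          have hge : g x = ENNReal.ofReal (g x).toReal := (ENNReal.ofReal_toReal hx.1.ne).symm
          have hpd : productDensity ρ x = ENNReal.ofReal (∏ i, ρ (x i)) :=
            (ENNReal.ofReal_prod_of_nonneg fun i _ => (hpos i).le).symm
          rw [Pi.smul_apply, smul_eq_mul, hpd, ← ENNReal.ofReal_mul hC.le, hge,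
            ENNReal.ofReal_le_ofReal_iff (mul_pos hC hR).le] at hxle
          conv_rhs => rw [hge]
          rw [← ENNReal.ofReal_sum_of_nonneg fun i _ => abs_nonneg _,
            ← ENNReal.ofReal_add (abs_nonneg _) (Finset.sum_nonneg fun i _ => abs_nonneg _),
            ← ENNReal.ofReal_mul hgr.le]
          refine ENNReal.ofReal_le_ofReal (mul_le_mul_of_nonneg_left ?_ hgr.le)
          refine (Real.log_le_log hgr hxle).trans ?_
          rw [Real.log_mul hC.ne' hR.ne', Real.log_prod (fun i _ => (hpos i).ne')]
          exact add_le_add (le_abs_self _) (Finset.sum_le_sum fun i _ => le_abs_self _)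
      _ = ENNReal.ofReal |Real.log C| +
          N * ∫⁻ x, ENNReal.ofReal |Real.log (ρ x)| ∂(densityMeasure m ρ) := by
          rw [hg, lintegral_rnDeriv_mul_eq hac hms, lintegral_add_left measurable_const,
            hγ.lintegral_sum_abs_log hρ, lintegral_const, measure_univ, mul_one]
      _ < ⊤ := ENNReal.add_lt_top.2 ⟨ENNReal.ofReal_lt_top, ENNReal.mul_lt_top
          (ENNReal.natCast_lt_top N) (lintegral_abs_log_ne_top hρ hρ0 hlog).lt_top⟩
  unfold extIntegral
  refine lt_of_le_of_lt (b := ((∫⁻ x, (((g x).toReal * Real.log (g x).toReal : ℝ) :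
    EReal).toENNReal ∂(Measure.pi fun _ => m) : ℝ≥0∞) : EReal)) ?_ ?_
  · rw [sub_eq_add_neg]
    refine add_le_of_nonpos_right ?_
    rw [← neg_zero, EReal.neg_le_neg_iff]
    exact EReal.coe_ennreal_nonneg _
  · rw [lt_top_iff_ne_top, Ne, EReal.coe_ennreal_eq_top_iff]
    exact hpos.ne

end

/-! ### Lower semicontinuity -/

/-- Narrow lower semicontinuity of the integral of a continuous function with values in `[0, ∞]`,
by truncation. -/
theorem lintegral_le_liminf_of_tendsto {Ω : Type*} [MeasurableSpace Ω] [TopologicalSpace Ω]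
    [OpensMeasurableSpace Ω] [HasOuterApproxClosed Ω] {γ : ProbabilityMeasure Ω}
    {γs : ℕ → ProbabilityMeasure Ω} (h : Tendsto γs atTop (𝓝 γ)) {F : Ω → ℝ≥0∞}
    (hF : Continuous F) :
    ∫⁻ x, F x ∂(γ : Measure Ω) ≤ liminf (fun n => ∫⁻ x, F x ∂(γs n : Measure Ω)) atTop := by
  have hsup : ∀ x, F x = ⨆ k : ℕ, min (F x) k := by
    intro x
    rw [← inf_iSup_eq, ENNReal.iSup_natCast, inf_top_eq]
  have hmeas : ∀ k : ℕ, Continuous fun x => min (F x) (k : ℝ≥0∞) := fun k => hF.min continuous_const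
  have h1 : ∫⁻ x, F x ∂(γ : Measure Ω) = ⨆ k : ℕ, ∫⁻ x, min (F x) k ∂(γ : Measure Ω) := by
    rw [← lintegral_iSup (fun k => (hmeas k).measurable)]
    · exact lintegral_congr hsup
    · intro k l hkl x
      exact min_le_min le_rfl (by exact_mod_cast hkl)
  rw [h1]
  refine iSup_le fun k => ?_
  have htop : ∀ x, min (F x) (k : ℝ≥0∞) ≠ ⊤ := fun x =>
    ((min_le_right _ _).trans_lt (ENNReal.natCast_lt_top k)).ne
  have hcont : Continuous fun x => (min (F x) (k : ℝ≥0∞)).toReal := by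
    rw [continuous_iff_continuousAt]
    intro x
    exact (ENNReal.tendsto_toReal (htop x)).comp (hmeas k).continuousAt
  have h2 := lintegral_le_liminf_lintegral_of_forall_isOpen_measure_le_liminf_measure
    (μ := (γ : Measure Ω)) (μs := fun n => (γs n : Measure Ω)) hcont
    (fun x => ENNReal.toReal_nonneg)
    fun G hG => ProbabilityMeasure.le_liminf_measure_open_of_tendsto h hG
  simp_rw [ENNReal.ofReal_toReal (htop _)] at h2
  refine h2.trans (liminf_le_liminf (Eventually.of_forall fun n => ?_))
  exact lintegral_mono fun x => min_le_left _ _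

section

variable {X : Type*} [MetricSpace X] [PolishSpace X] [MeasurableSpace X] [BorelSpace X] {N : ℕ}

/-- Narrow limits of couplings of `μ` are couplings of `μ`. -/
theorem IsCoupling.of_frequently {μ : Measure X} {γ : ProbabilityMeasure (Fin N → X)}
    {γs : ℕ → ProbabilityMeasure (Fin N → X)} (h : Tendsto γs atTop (𝓝 γ))
    (hc : ∃ᶠ n in atTop, IsCoupling μ (γs n)) : IsCoupling μ γ := by
  intro i
  have hmap := ProbabilityMeasure.tendsto_map_of_tendsto_of_continuous γs γ h
    (continuous_apply i : Continuous fun x : Fin N → X => x i)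
  obtain ⟨n₀, hn₀⟩ := hc.exists
  set ν : ProbabilityMeasure X := (γs n₀).map
    (continuous_apply i : Continuous fun x : Fin N → X => x i).measurable.aemeasurable with hν
  have hνμ : (ν : Measure X) = μ := by rw [← hn₀ i]; rfl
  have hmem := isClosed_singleton.mem_of_frequently_of_tendsto (s := ({ν} : Set _))
    (hc.mono fun n hn => ?_) hmap
  · rw [← hνμ, ← Set.mem_singleton_iff.1 hmem]
    rfl
  · rw [Set.mem_singleton_iff]
    apply Subtype.ext
    change (γs n : Measure (Fin N → X)).map (fun x => x i) = (ν : Measure X)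
    rw [hνμ, hn i]

theorem monotone_coe_sub (A : ℝ≥0∞) : Monotone fun x : ℝ≥0∞ => (x : EReal) - (A : EReal) :=
  fun _ _ h => EReal.sub_le_sub (EReal.coe_ennreal_le_coe_ennreal_iff.2 h) le_rfl

theorem continuous_coe_sub {A : ℝ≥0∞} (hA : A ≠ ⊤) :
    Continuous fun x : ℝ≥0∞ => (x : EReal) - (A : EReal) := by
  lift A to NNReal using hA
  rw [continuous_iff_continuousAt]
  intro x
  simp only [sub_eq_add_neg]
  have h1 : ContinuousAt (fun p : EReal × EReal => p.1 + p.2)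
      ((x : EReal), -(((A : ℝ≥0∞)) : EReal)) :=
    EReal.continuousAt_add (Or.inr (by simp)) (Or.inl (by simp))
  exact ContinuousAt.comp (f := fun x : ℝ≥0∞ => ((x : EReal), -((A : ℝ≥0∞) : EReal))) h1
    ((continuous_coe_ennreal_ereal.prodMk continuous_const).continuousAt)

variable {m : Measure X} [SigmaFinite m] {ρ : X → ℝ} {f : ℝ → ℝ}

theorem bot_lt_coe_sub (x : ℝ≥0∞) {A : ℝ≥0∞} (hA : A ≠ ⊤) : ⊥ < (x : EReal) - (A : EReal) := by
  lift A to NNReal using hA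
  rw [bot_lt_iff_ne_bot, sub_eq_add_neg, Ne, EReal.add_eq_bot_iff]
  simp

omit [PolishSpace X] [BorelSpace X] in
theorem compensationConst_ne_top {o : X} {μ : Measure X}
    (hμ : ∫⁻ x, ENNReal.ofReal (tailWeight f o x) ∂μ ≠ ⊤) : compensationConst N f o μ ≠ ⊤ :=
  ENNReal.sum_ne_top.2 fun _ _ => ENNReal.add_ne_top.2 ⟨hμ, hμ⟩

theorem le_transportCost_liminf (hf : IsRepulsive f) {o : X} {μ : Measure X}
    (hμ : ∫⁻ x, ENNReal.ofReal (tailWeight f o x) ∂μ ≠ ⊤) {γ : ProbabilityMeasure (Fin N → X)}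
    {γs : ℕ → ProbabilityMeasure (Fin N → X)} (h : Tendsto γs atTop (𝓝 γ))
    (hγ : IsCoupling μ γ) :
    transportCost f γ ≤ liminf (fun n =>
      ((∫⁻ x, compCost f o x ∂(γs n : Measure (Fin N → X)) : ℝ≥0∞) : EReal) -
        (compensationConst N f o μ : EReal)) atTop := by
  rw [hf.transportCost_eq o hμ hγ]
  have h1 := lintegral_le_liminf_of_tendsto h (hf.continuous_compCost o)
  have hA := compensationConst_ne_top (N := N) hμ
  have h2 := (monotone_coe_sub (compensationConst N f o μ)).map_liminf_of_continuousAt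
    (F := atTop) (fun n => ∫⁻ x, compCost f o x ∂(γs n : Measure (Fin N → X)))
    (continuous_coe_sub hA).continuousAt
  exact (monotone_coe_sub _ h1).trans h2.le

/-- The lower bound inequality of the Gamma-convergence: the transport cost is lower semicontinuous
on the couplings, and the entropies of the couplings are uniformly bounded below. -/
theorem limitFunctional_le_liminf [IsProbabilityMeasure (densityMeasure m ρ)] (hρ : Measurable ρ)
    (hρ0 : ∀ x, 0 ≤ ρ x) (hlog : Integrable (fun x => ρ x * Real.log (ρ x)) m)
    (hf : IsRepulsive f) {o : X}
    (hμ : ∫⁻ x, ENNReal.ofReal (tailWeight f o x) ∂(densityMeasure m ρ) ≠ ⊤) {τ : ℕ → ℝ}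
    (hτ : ∀ n, 0 < τ n) (hτ0 : Tendsto τ atTop (𝓝 0)) {γ : SymProb X N} {u : ℕ → SymProb X N}
    (h : Tendsto u atTop (𝓝 γ)) :
    limitFunctional m ρ f γ ≤
      liminf (fun n => regularizedFunctional m ρ f (τ n) (u n)) atTop := by
  have h' : Tendsto (fun n => (u n).1) atTop (𝓝 γ.1) := (tendsto_subtype_rng).1 h
  by_cases hc : ∃ᶠ n in atTop, IsCoupling (densityMeasure m ρ) (u n).1
  swap
  · rw [not_frequently] at hc
    have : (fun n => regularizedFunctional m ρ f (τ n) (u n)) =ᶠ[atTop] fun _ => ⊤ := by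
      filter_upwards [hc] with n hn
      exact if_neg hn
    rw [liminf_congr this, liminf_const]
    exact le_top
  have hγ := IsCoupling.of_frequently h' hc
  unfold limitFunctional
  rw [if_pos hγ]
  set A := compensationConst N f o (densityMeasure m ρ) with hA
  have hAtop : A ≠ ⊤ := compensationConst_ne_top hμ
  set K : ℝ≥0∞ := 1 + N * ∫⁻ x, ENNReal.ofReal |Real.log (ρ x)| ∂(densityMeasure m ρ) with hK
  have hKtop : K ≠ ⊤ := ENNReal.add_ne_top.2 ⟨ENNReal.one_ne_top,
    ENNReal.mul_ne_top (ENNReal.natCast_ne_top N) (lintegral_abs_log_ne_top hρ hρ0 hlog)⟩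
  have hlow : ∀ n, (((∫⁻ x, compCost f o x ∂((u n).1 : Measure (Fin N → X)) : ℝ≥0∞) : EReal) - A) +
      ((-(τ n * K.toReal) : ℝ) : EReal) ≤ regularizedFunctional m ρ f (τ n) (u n) := by
    intro n
    unfold regularizedFunctional
    split_ifs with hn
    · rw [hf.transportCost_eq o hμ hn]
      refine add_le_add le_rfl ?_
      have h1 := hn.le_entropy hρ (m := m)
      rw [← hK, ← EReal.coe_ennreal_toReal hKtop] at h1
      have h2 := mul_le_mul_of_nonneg_left h1 (by exact_mod_cast (hτ n).le : (0 : EReal) ≤ τ n)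
      refine le_trans (le_of_eq ?_) h2
      rw [← EReal.coe_neg, ← EReal.coe_mul, mul_neg]
    · exact le_top
  have hlim : Tendsto (fun n => ((-(τ n * K.toReal) : ℝ) : EReal)) atTop (𝓝 0) := by
    have : Tendsto (fun n => -(τ n * K.toReal)) atTop (𝓝 0) := by
      simpa using (hτ0.mul_const K.toReal).neg
    exact (continuous_coe_real_ereal.tendsto 0).comp this
  calc transportCost f γ.1 ≤ _ := le_transportCost_liminf hf hμ h' hγ
    _ = liminf (fun n => ((∫⁻ x, compCost f o x ∂((u n).1 : Measure (Fin N → X)) : ℝ≥0∞) : EReal) - A)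
        atTop + liminf (fun n => ((-(τ n * K.toReal) : ℝ) : EReal)) atTop := by
        rw [hlim.liminf_eq, add_zero]
    _ ≤ liminf (fun n => (((∫⁻ x, compCost f o x ∂((u n).1 : Measure (Fin N → X)) : ℝ≥0∞) : EReal)
        - A) + ((-(τ n * K.toReal) : ℝ) : EReal)) atTop :=
        EReal.le_liminf_add
    _ ≤ _ := liminf_le_liminf (Eventually.of_forall hlow)

theorem bot_lt_transportCost (hf : IsRepulsive f) {o : X} {μ : Measure X}
    (hμ : ∫⁻ x, ENNReal.ofReal (tailWeight f o x) ∂μ ≠ ⊤) {γ : ProbabilityMeasure (Fin N → X)}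
    (hγ : IsCoupling μ γ) : ⊥ < transportCost f γ := by
  rw [hf.transportCost_eq o hμ hγ]
  exact bot_lt_coe_sub _ (compensationConst_ne_top hμ)

omit [MetricSpace X] [PolishSpace X] [BorelSpace X] in
theorem IsCoupling.bot_lt_entropy [IsProbabilityMeasure (densityMeasure m ρ)] (hρ : Measurable ρ)
    (hρ0 : ∀ x, 0 ≤ ρ x) (hlog : Integrable (fun x => ρ x * Real.log (ρ x)) m)
    {γ : ProbabilityMeasure (Fin N → X)} (hγ : IsCoupling (densityMeasure m ρ) γ) :
    ⊥ < entropy m γ := by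
  refine lt_of_lt_of_le ?_ (hγ.le_entropy hρ)
  rw [bot_lt_iff_ne_bot, Ne, EReal.neg_eq_bot_iff, EReal.coe_ennreal_eq_top_iff]
  exact ENNReal.add_ne_top.2 ⟨ENNReal.one_ne_top,
    ENNReal.mul_ne_top (ENNReal.natCast_ne_top N) (lintegral_abs_log_ne_top hρ hρ0 hlog)⟩

theorem bot_lt_functionals [IsProbabilityMeasure (densityMeasure m ρ)] (hρ : Measurable ρ)
    (hρ0 : ∀ x, 0 ≤ ρ x) (hlog : Integrable (fun x => ρ x * Real.log (ρ x)) m)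
    (hf : IsRepulsive f) {o : X}
    (hμ : ∫⁻ x, ENNReal.ofReal (tailWeight f o x) ∂(densityMeasure m ρ) ≠ ⊤) {ε : ℝ} (hε : 0 < ε)
    (γ : SymProb X N) : ⊥ < limitFunctional m ρ f γ ∧ ⊥ < regularizedFunctional m ρ f ε γ := by
  unfold limitFunctional regularizedFunctional
  split_ifs with hγ
  · refine ⟨bot_lt_transportCost hf hμ hγ, ?_⟩
    have h1 := bot_lt_transportCost hf hμ hγ
    have h2 := hγ.bot_lt_entropy hρ hρ0 hlog (m := m)
    rw [bot_lt_iff_ne_bot, Ne, EReal.add_eq_bot_iff, not_or]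
    refine ⟨h1.ne', ?_⟩
    rw [← Ne, ← bot_lt_iff_ne_bot]
    revert h2
    induction entropy m γ.1 using EReal.rec with
    | bot => exact fun h2 => absurd h2 (lt_irrefl _)
    | top => intro _; rw [EReal.coe_mul_top_of_pos hε]; exact bot_lt_top
    | coe r => intro _; rw [← EReal.coe_mul]; exact EReal.bot_lt_coe _
  · exact ⟨bot_lt_top, bot_lt_top⟩

end

/-! ### Block measures -/

section Block

variable {X : Type*} [MeasurableSpace X] {N : ℕ} {L : Type*}

/-- The product cell of the points of `X^N` with labels `k`. -/
def cell (ℓ : X → L) (k : Fin N → L) : Set (Fin N → X) := Set.univ.pi fun i => ℓ ⁻¹' {k i}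

omit [MeasurableSpace X] in
theorem mem_cell {ℓ : X → L} {k : Fin N → L} {x : Fin N → X} : x ∈ cell ℓ k ↔ ∀ i, ℓ (x i) = k i := by
  simp [cell, Set.mem_pi]

omit [MeasurableSpace X] in
theorem mem_cell_self (ℓ : X → L) (x : Fin N → X) : x ∈ cell ℓ (fun i => ℓ (x i)) :=
  mem_cell.2 fun _ => rfl

/-- The normalized restriction of `μ^{⊗ N}` to the cell with labels `k`. -/
def cellMeasure (μ : Measure X) (ℓ : X → L) (k : Fin N → L) : Measure (Fin N → X) :=
  Measure.pi fun i => ProbabilityTheory.cond μ (ℓ ⁻¹' {k i})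

variable [Fintype L] [MeasurableSpace L] [DiscreteMeasurableSpace L]

/-- The block measure giving the mass `W k`, distributed as `μ^{⊗ N}`, to the cell with labels `k`. -/
def blockMeasure (μ : Measure X) (ℓ : X → L) (W : (Fin N → L) → ℝ≥0∞) : Measure (Fin N → X) :=
  ∑ k, W k • cellMeasure μ ℓ k

variable {μ : Measure X} [IsProbabilityMeasure μ] {ℓ : X → L} (hℓ : Measurable ℓ)
include hℓ

omit [Fintype L] in
theorem measurableSet_cell (k : Fin N → L) : MeasurableSet (cell ℓ k) :=
  MeasurableSet.univ_pi fun _ => hℓ (measurableSet_singleton _)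

omit [Fintype L] in
theorem cellMeasure_eq (k : Fin N → L) :
    cellMeasure μ ℓ k =
      (∏ i, (μ (ℓ ⁻¹' {k i}))⁻¹) • (Measure.pi fun _ => μ).restrict (cell ℓ k) := by
  refine Measure.pi_eq fun s hs => ?_
  rw [Measure.smul_apply, Measure.restrict_apply (MeasurableSet.univ_pi hs), cell,
    ← Set.pi_inter_distrib, Measure.pi_pi, smul_eq_mul, ← Finset.prod_mul_distrib]
  refine Finset.prod_congr rfl fun i _ => ?_
  rw [ProbabilityTheory.cond_apply (hℓ (measurableSet_singleton _)), Set.inter_comm]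

omit [Fintype L] hℓ [MeasurableSpace L] [DiscreteMeasurableSpace L] in
theorem isProbabilityMeasure_cellMeasure {k : Fin N → L} (hk : ∀ i, μ (ℓ ⁻¹' {k i}) ≠ 0) :
    IsProbabilityMeasure (cellMeasure μ ℓ k) := by
  have := fun i => ProbabilityTheory.cond_isProbabilityMeasure (hk i)
  unfold cellMeasure
  infer_instance

omit [Fintype L] in
theorem cellMeasure_compl (k : Fin N → L) :
    cellMeasure μ ℓ k (cell ℓ k)ᶜ = 0 := by
  rw [cellMeasure_eq hℓ k, Measure.smul_apply, Measure.restrict_apply'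
    (measurableSet_cell hℓ k), Set.compl_inter_self, measure_empty, smul_zero]

omit [Fintype L] in
theorem ae_mem_cell (k : Fin N → L) :
    ∀ᵐ x ∂(cellMeasure μ ℓ k), x ∈ cell ℓ k := cellMeasure_compl hℓ k

omit [Fintype L] [MeasurableSpace L] [DiscreteMeasurableSpace L] [IsProbabilityMeasure μ] hℓ in
/-- A scalar multiple of a product measure is a product measure: the factor is put on the coordinate
`0`. -/
theorem smul_pi_eq_pi [NeZero N] (ν : Fin N → Measure X) [∀ i, IsFiniteMeasure (ν i)] {c : ℝ≥0∞}
    (hc : c ≠ ⊤) : ∃ ν' : Fin N → Measure X, (∀ i, IsFiniteMeasure (ν' i)) ∧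
      c • Measure.pi ν = Measure.pi ν' := by
  have hfin : ∀ i, IsFiniteMeasure (if i = 0 then c • ν i else ν i) := by
    intro i
    split_ifs
    · exact Measure.smul_finite _ hc
    · infer_instance
  refine ⟨fun i => if i = 0 then c • ν i else ν i, hfin, ?_⟩
  symm
  refine Measure.pi_eq fun s hs => ?_
  rw [Measure.smul_apply, Measure.pi_pi, smul_eq_mul,
    ← Finset.mul_prod_erase Finset.univ _ (Finset.mem_univ (0 : Fin N)),
    ← Finset.mul_prod_erase Finset.univ _ (Finset.mem_univ (0 : Fin N)), ← mul_assoc]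
  congr 1
  refine Finset.prod_congr rfl fun i hi => ?_
  simp only [if_neg (Finset.mem_erase.1 hi).1]

omit hℓ [MeasurableSpace L] [DiscreteMeasurableSpace L] [IsProbabilityMeasure μ] in
theorem isBlock_of_eq_blockMeasure [NeZero N] {W : (Fin N → L) → ℝ≥0∞} (hW : ∀ k, W k ≠ ⊤)
    {γ : ProbabilityMeasure (Fin N → X)} (hγ : (γ : Measure (Fin N → X)) = blockMeasure μ ℓ W) :
    IsBlock γ := by
  choose ν' hν' hν'eq using fun k : Fin N → L =>
    smul_pi_eq_pi (fun i => ProbabilityTheory.cond μ (ℓ ⁻¹' {k i})) (hW k)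
  classical
  let e := Fintype.equivFin (Fin N → L)
  refine ⟨Fintype.card (Fin N → L), fun a => ν' (e.symm a), fun a i => hν' _ i, ?_⟩
  rw [hγ, blockMeasure, Fintype.sum_equiv e _ (fun a => Measure.pi (ν' (e.symm a)))]
  intro k
  rw [e.symm_apply_apply]
  exact hν'eq k

omit hℓ [MeasurableSpace L] [DiscreteMeasurableSpace L] [IsProbabilityMeasure μ] in
theorem lintegral_blockMeasure (W : (Fin N → L) → ℝ≥0∞) (F : (Fin N → X) → ℝ≥0∞) :
    ∫⁻ x, F x ∂(blockMeasure μ ℓ W) = ∑ k, W k * ∫⁻ x, F x ∂(cellMeasure μ ℓ k) := by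
  unfold blockMeasure
  rw [lintegral_finsetSum_measure]
  exact Finset.sum_congr rfl fun k _ => lintegral_smul_measure _ _

omit hℓ [MeasurableSpace L] [DiscreteMeasurableSpace L] [IsProbabilityMeasure μ] in
theorem blockMeasure_apply (W : (Fin N → L) → ℝ≥0∞) (s : Set (Fin N → X)) :
    blockMeasure μ ℓ W s = ∑ k, W k * cellMeasure μ ℓ k s := by
  simp [blockMeasure, Measure.finsetSum_apply]

omit hℓ [MeasurableSpace L] [DiscreteMeasurableSpace L] [IsProbabilityMeasure μ] in
theorem blockMeasure_add (W W' : (Fin N → L) → ℝ≥0∞) :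
    blockMeasure μ ℓ (fun k => W k + W' k) = blockMeasure μ ℓ W + blockMeasure μ ℓ W' := by
  simp [blockMeasure, add_smul, Finset.sum_add_distrib]

theorem blockMeasure_eq_zero {W : (Fin N → L) → ℝ≥0∞} {s : Set (Fin N → X)}
    (hs : ∀ k, W k ≠ 0 → Disjoint (cell ℓ k) s) : blockMeasure μ ℓ W s = 0 := by
  rw [blockMeasure_apply]
  refine Finset.sum_eq_zero fun k _ => ?_
  by_cases hk : W k = 0
  · rw [hk, zero_mul]
  · rw [measure_mono_null (fun x hx hx' => Set.disjoint_left.1 (hs k hk) hx' hx)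
      (cellMeasure_compl hℓ k), mul_zero]

omit hℓ [MeasurableSpace L] [DiscreteMeasurableSpace L] in
theorem blockMeasure_univ {W : (Fin N → L) → ℝ≥0∞}
    (hpos : ∀ k, W k ≠ 0 → ∀ i, μ (ℓ ⁻¹' {k i}) ≠ 0) :
    blockMeasure μ ℓ W Set.univ = ∑ k, W k := by
  rw [blockMeasure_apply]
  refine Finset.sum_congr rfl fun k _ => ?_
  by_cases hk : W k = 0
  · rw [hk, zero_mul]
  · have := isProbabilityMeasure_cellMeasure (hpos k hk)
    rw [measure_univ, mul_one]

/-- A block measure whose weights have the marginals of `μ` has marginals `μ`. -/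
theorem blockMeasure_map_eval {W : (Fin N → L) → ℝ≥0∞}
    (hpos : ∀ k, W k ≠ 0 → ∀ i, μ (ℓ ⁻¹' {k i}) ≠ 0)
    (hW : ∀ (j : Fin N) (φ : L → ℝ≥0∞), ∑ k, W k * φ (k j) = ∑ l, μ (ℓ ⁻¹' {l}) * φ l)
    (j : Fin N) : (blockMeasure μ ℓ W).map (fun x => x j) = μ := by
  ext s hs
  rw [Measure.map_apply (measurable_pi_apply j) hs, blockMeasure_apply]
  have h1 : ∀ k, W k * cellMeasure μ ℓ k ((fun x => x j) ⁻¹' s) =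
      W k * ProbabilityTheory.cond μ (ℓ ⁻¹' {k j}) s := by
    intro k
    by_cases hk : W k = 0
    · rw [hk, zero_mul, zero_mul]
    · have := fun i => ProbabilityTheory.cond_isProbabilityMeasure (hpos k hk i)
      rw [cellMeasure, (measurePreserving_eval (fun i => ProbabilityTheory.cond μ (ℓ ⁻¹' {k i})) j
        ).measure_preimage hs.nullMeasurableSet]
  simp_rw [h1]
  rw [hW j fun l => ProbabilityTheory.cond μ (ℓ ⁻¹' {l}) s]
  conv_rhs => rw [← ProbabilityTheory.sum_meas_smul_cond_fiber hℓ μ]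
  simp [Measure.finsetSum_apply]

omit hℓ [MeasurableSpace L] [DiscreteMeasurableSpace L] [IsProbabilityMeasure μ] in
theorem blockMeasure_map_perm {W : (Fin N → L) → ℝ≥0∞} (σ : Equiv.Perm (Fin N))
    (hσ : ∀ k, W (k ∘ σ) = W k) :
    (blockMeasure μ ℓ W).map (fun x => x ∘ σ) = blockMeasure μ ℓ W := by
  have hm : Measurable fun x : Fin N → X => x ∘ σ :=
    measurable_pi_lambda _ fun i => measurable_pi_apply _
  have hcell : ∀ k : Fin N → L,
      (cellMeasure μ ℓ k).map (fun x => x ∘ σ) = cellMeasure μ ℓ (k ∘ σ) := by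
    intro k
    symm
    refine Measure.pi_eq fun s hs => ?_
    rw [Measure.map_apply hm (MeasurableSet.univ_pi hs)]
    have : (fun x : Fin N → X => x ∘ σ) ⁻¹' Set.univ.pi s = Set.univ.pi fun i => s (σ⁻¹ i) := by
      ext x
      simp only [Set.mem_preimage, Set.mem_pi, Set.mem_univ, true_implies, Function.comp]
      refine ⟨fun h i => by simpa using h (σ⁻¹ i), fun h i => by simpa using h (σ i)⟩
    rw [this, cellMeasure, Measure.pi_pi]
    exact Fintype.prod_equiv σ.symm _ _ fun i => by simp
  ext s hs
  rw [Measure.map_apply hm hs, blockMeasure_apply, blockMeasure_apply]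
  refine Fintype.sum_equiv (Equiv.arrowCongr σ.symm (Equiv.refl L)) _ _ fun k => ?_
  have hk : (Equiv.arrowCongr σ.symm (Equiv.refl L)) k = k ∘ σ := rfl
  rw [hk, hσ, ← hcell, Measure.map_apply hm hs]

theorem exists_blockMeasure_le {W : (Fin N → L) → ℝ≥0∞} (hWtop : ∀ k, W k ≠ ⊤)
    (hpos : ∀ k, W k ≠ 0 → ∀ i, μ (ℓ ⁻¹' {k i}) ≠ 0) :
    ∃ C : ℝ, 0 < C ∧ blockMeasure μ ℓ W ≤ ENNReal.ofReal C • Measure.pi fun _ => μ := by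
  set c : ℝ≥0∞ := ∑ k, W k * ∏ i, (μ (ℓ ⁻¹' {k i}))⁻¹ with hc
  have hctop : c ≠ ⊤ := by
    refine ENNReal.sum_ne_top.2 fun k _ => ?_
    by_cases hk : W k = 0
    · rw [hk, zero_mul]; exact ENNReal.zero_ne_top
    · exact ENNReal.mul_ne_top (hWtop k)
        (ENNReal.prod_ne_top fun i _ => ENNReal.inv_ne_top.2 (hpos k hk i))
  refine ⟨c.toReal + 1, by positivity, ?_⟩
  have h1 : blockMeasure μ ℓ W ≤ c • Measure.pi fun _ => μ := by
    refine Measure.le_iff.2 fun s hs => ?_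
    rw [blockMeasure_apply, Measure.smul_apply, smul_eq_mul, hc, Finset.sum_mul]
    refine Finset.sum_le_sum fun k _ => ?_
    by_cases hk : W k = 0
    · rw [hk, zero_mul, zero_mul, zero_mul]
    · rw [cellMeasure_eq hℓ k, Measure.smul_apply, smul_eq_mul, mul_assoc]
      exact mul_le_mul_right (mul_le_mul_right (Measure.restrict_apply_le _ _) _) _
  refine h1.trans (Measure.le_iff.2 fun s _ => ?_)
  rw [Measure.smul_apply, Measure.smul_apply, smul_eq_mul, smul_eq_mul]
  gcongr
  rw [ENNReal.ofReal_add ENNReal.toReal_nonneg zero_le_one, ENNReal.ofReal_toReal hctop]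
  exact le_self_add

/-- Comparison of a block measure with a measure charging each cell at least as much. -/
theorem lintegral_blockMeasure_le {W : (Fin N → L) → ℝ≥0∞}
    (hpos : ∀ k, W k ≠ 0 → ∀ i, μ (ℓ ⁻¹' {k i}) ≠ 0) {γ : Measure (Fin N → X)}
    (hWγ : ∀ k, W k ≤ γ (cell ℓ k)) {Φ Ψ : (Fin N → X) → ℝ≥0∞}
    (hΦΨ : ∀ k, W k ≠ 0 → ∀ x ∈ cell ℓ k, ∀ y ∈ cell ℓ k, Φ x ≤ Ψ y) :
    ∫⁻ x, Φ x ∂(blockMeasure μ ℓ W) ≤ ∫⁻ x, Ψ x ∂γ := by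
  rw [lintegral_blockMeasure]
  have hunion : (⋃ k ∈ (Finset.univ : Finset (Fin N → L)), cell ℓ k) = Set.univ := by
    ext x
    simp only [Finset.mem_univ, Set.iUnion_true, Set.mem_iUnion, Set.mem_univ, iff_true]
    exact ⟨_, mem_cell_self ℓ x⟩
  have hdisj : Set.PairwiseDisjoint ((Finset.univ : Finset (Fin N → L)) : Set (Fin N → L)) (cell ℓ) := by
    intro k _ k' _ hkk'
    refine Set.disjoint_left.2 fun x hx hx' => hkk' ?_
    funext i
    rw [← mem_cell.1 hx i, mem_cell.1 hx' i]
  calc _ ≤ ∑ k, ∫⁻ x in cell ℓ k, Ψ x ∂γ := by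
        refine Finset.sum_le_sum fun k _ => ?_
        by_cases hk : W k = 0
        · rw [hk, zero_mul]; exact zero_le
        have := isProbabilityMeasure_cellMeasure (hpos k hk)
        have h1 : ∫⁻ x, Φ x ∂(cellMeasure μ ℓ k) ≤ ⨅ y ∈ cell ℓ k, Ψ y := by
          calc _ ≤ ∫⁻ _, (⨅ y ∈ cell ℓ k, Ψ y) ∂(cellMeasure μ ℓ k) := by
                refine lintegral_mono_ae ?_
                filter_upwards [ae_mem_cell hℓ k] with x hx
                exact le_iInf₂ fun y hy => hΦΨ k hk x hx y hy
            _ = _ := by rw [lintegral_const, measure_univ, mul_one]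
        calc _ ≤ γ (cell ℓ k) * ⨅ y ∈ cell ℓ k, Ψ y := mul_le_mul' (hWγ k) h1
          _ = ∫⁻ _ in cell ℓ k, (⨅ y ∈ cell ℓ k, Ψ y) ∂γ := by
              rw [setLIntegral_const, mul_comm]
          _ ≤ _ := setLIntegral_mono' (measurableSet_cell hℓ k) fun x hx => iInf₂_le x hx
    _ = ∫⁻ x, Ψ x ∂γ := by
        rw [← lintegral_biUnion_finset hdisj (fun k _ => measurableSet_cell hℓ k), hunion,
          setLIntegral_univ]

end Block

/-! ### Two-scale labellings and integrability -/

/-- Finite labelling of a separable space at two scales. The cells with a `Fine` label have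
diameter less than `ε` and cover all but a mass `δ`. Every cell is either contained in a ball of
radius `2 r`, or at distance at least `r` from all the fine cells. -/
theorem exists_labelling {X : Type*} [MetricSpace X] [SecondCountableTopology X]
    [MeasurableSpace X] [BorelSpace X] (μ : Measure X) [IsProbabilityMeasure μ] {r ε : ℝ}
    (hr : 0 < r) (hε : 0 < ε) (hεr : ε ≤ r) {δ : ℝ≥0∞} (hδ : 0 < δ) :
    ∃ (P : ℕ) (ℓ : X → Bool × Fin (P + 1)) (Fine : Bool × Fin (P + 1) → Prop), Measurable ℓ ∧
      (∀ x y, ℓ x = ℓ y → Fine (ℓ x) → dist x y < ε) ∧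
      (∀ l, (∃ z, ∀ x, ℓ x = l → dist x z < 2 * r) ∨
        ∀ x y, ℓ x = l → Fine (ℓ y) → r ≤ dist x y) ∧
      μ {x | ¬ Fine (ℓ x)} ≤ δ := by
  classical
  have : Nonempty X := μ.nonempty_of_neZero
  set w := TopologicalSpace.denseSeq X with hw
  have hdense := TopologicalSpace.denseRange_denseSeq X
  -- the fine balls `B (w i) (ε / 2)`, `i < P`, cover all but a small mass
  have hP : ∃ P : ℕ, μ (⋂ i ∈ Set.Iio P, (Metric.ball (w i) (ε / 2))ᶜ) ≤ δ := by
    have htend : Tendsto (fun P : ℕ => μ (⋂ i ∈ Set.Iio P, (Metric.ball (w i) (ε / 2))ᶜ)) atTop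
        (𝓝 (μ (⋂ P : ℕ, ⋂ i ∈ Set.Iio P, (Metric.ball (w i) (ε / 2))ᶜ))) := by
      refine tendsto_measure_iInter_atTop (fun P => ?_) (fun P Q hPQ => ?_)
        ⟨0, measure_ne_top _ _⟩
      · exact (MeasurableSet.biInter (Set.to_countable _)
          fun i _ => measurableSet_ball.compl).nullMeasurableSet
      · exact Set.biInter_subset_biInter_left (Set.Iio_subset_Iio hPQ)
    have hempty : (⋂ P : ℕ, ⋂ i ∈ Set.Iio P, (Metric.ball (w i) (ε / 2))ᶜ) = ∅ := by
      rw [Set.eq_empty_iff_forall_notMem]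
      intro x hx
      obtain ⟨i, hi⟩ := hdense.exists_dist_lt x (half_pos hε)
      simp only [Set.mem_iInter, Set.mem_compl_iff, Set.mem_Iio] at hx
      exact hx (i + 1) i (Nat.lt_succ_self i) (Metric.mem_ball.2 hi)
    rw [hempty, measure_empty] at htend
    exact ((htend.eventually_lt_const hδ).exists).imp fun P h => h.le
  obtain ⟨P, hP⟩ := hP
  have hex : ∀ (s : ℝ) (x : X), ∃ i, i = P ∨ dist x (w i) < s := fun s x => ⟨P, Or.inl rfl⟩
  set idx : ℝ → X → ℕ := fun s x => Nat.find (hex s x) with hidx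
  have hidxm : ∀ s, Measurable (idx s) := by
    intro s
    refine measurable_find (hex s) fun k => ?_
    by_cases hk : k = P
    · simp [hk]
    · simp only [hk, false_or]
      exact measurableSet_ball
  have hidxle : ∀ s x, idx s x ≤ P := fun s x => Nat.find_min' _ (Or.inl rfl)
  have hidxlt : ∀ s x, idx s x < P → dist x (w (idx s x)) < s := by
    intro s x h
    have := Nat.find_spec (hex s x)
    exact this.resolve_left h.ne
  have hlt : ∀ s x i, i < P → dist x (w i) < s → idx s x < P := by
    intro s x i hi h
    exact (Nat.find_min' (hex s x) (Or.inr h)).trans_lt hi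
  set ℓ : X → Bool × Fin (P + 1) := fun x =>
    if idx (ε / 2) x < P then (true, Fin.ofNat (P + 1) (idx (ε / 2) x))
    else (false, Fin.ofNat (P + 1) (idx (2 * r) x)) with hℓ
  have hval : ∀ s x, ((Fin.ofNat (P + 1) (idx s x) : Fin (P + 1)) : ℕ) = idx s x := by
    intro s x
    simp [Fin.ofNat, Nat.mod_eq_of_lt (Nat.lt_succ_of_le (hidxle s x))]
  refine ⟨P, ℓ, fun l => l.1 = true, ?_, ?_, ?_, ?_⟩
  · refine Measurable.ite ((hidxm _) (measurableSet_Iio (a := P))) ?_ ?_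
    · exact (measurable_from_top (f := fun n : ℕ => ((true, Fin.ofNat (P + 1) n) :
        Bool × Fin (P + 1)))).comp (hidxm _)
    · exact (measurable_from_top (f := fun n : ℕ => ((false, Fin.ofNat (P + 1) n) :
        Bool × Fin (P + 1)))).comp (hidxm _)
  · intro x y hxy hx
    have hx' : idx (ε / 2) x < P := by
      by_contra h
      simp [hℓ, h] at hx
    have hy' : idx (ε / 2) y < P := by
      by_contra h
      rw [hxy] at hx
      simp [hℓ, h] at hx
    have heq : idx (ε / 2) x = idx (ε / 2) y := by
      simp only [hℓ, if_pos hx', if_pos hy', Prod.mk.injEq, true_and] at hxy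
      rw [← hval, hxy, hval]
    have h1 := hidxlt _ _ hx'
    have h2 := hidxlt _ _ hy'
    rw [← heq] at h2
    have := dist_triangle_right x y (w (idx (ε / 2) x))
    linarith
  · intro l
    by_cases hl : (l.2 : ℕ) < P
    · left
      refine ⟨w l.2, fun x hx => ?_⟩
      by_cases h : idx (ε / 2) x < P
      · simp only [hℓ, if_pos h] at hx
        rw [← hx]
        simp only [hval]
        linarith [hidxlt _ _ h]
      · simp only [hℓ, if_neg h] at hx
        rw [← hx] at hl ⊢
        simp only [hval] at hl ⊢
        exact hidxlt _ _ hl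
    · right
      intro x y hx hy
      have hy' : idx (ε / 2) y < P := by
        by_contra h
        simp [hℓ, h] at hy
      have h1 := hidxlt _ _ hy'
      by_contra! hxy
      have hxw : dist x (w (idx (ε / 2) y)) < 2 * r := by
        have := dist_triangle x y (w (idx (ε / 2) y))
        linarith
      apply hl
      rw [← hx]
      by_cases h : idx (ε / 2) x < P
      · simpa only [hℓ, if_pos h, hval] using h
      · simp only [hℓ, if_neg h, hval]
        exact hlt _ _ _ hy' hxw
  · refine le_trans (measure_mono fun x hx => ?_) hP
    simp only [Set.mem_iInter, Set.mem_compl_iff, Set.mem_Iio, Metric.mem_ball]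
    intro i hi h
    have := hlt _ _ _ hi h
    simp [hℓ, this] at hx

/-- Uniform integrability of `h` over the measures dominated by `μ`. -/
theorem exists_forall_lintegral_le {X : Type*} [MeasurableSpace X] {μ : Measure X} {h : X → ℝ≥0∞}
    (hm : Measurable h) (hfin : ∫⁻ x, h x ∂μ ≠ ⊤) {η : ℝ≥0∞} (hη : η ≠ 0) :
    ∃ δ : ℝ, 0 < δ ∧ ∀ e : Measure X, e ≤ μ → e Set.univ ≤ ENNReal.ofReal δ →
      ∫⁻ x, h x ∂e ≤ η := by
  by_cases hηtop : η = ⊤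
  · exact ⟨1, one_pos, fun e _ _ => hηtop ▸ le_top⟩
  have hη2 : η / 2 ≠ 0 := (ENNReal.half_pos hη).ne'
  have hmk : ∀ k : ℕ, Measurable fun x => min (h x) (k : ℝ≥0∞) := fun k => hm.min measurable_const
  have hsup : ∫⁻ x, h x ∂μ = ⨆ k : ℕ, ∫⁻ x, min (h x) k ∂μ := by
    rw [← lintegral_iSup hmk]
    · refine lintegral_congr fun x => ?_
      rw [← inf_iSup_eq, ENNReal.iSup_natCast, inf_top_eq]
    · intro k l hkl x
      exact min_le_min le_rfl (by exact_mod_cast hkl)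
  obtain ⟨k, hk⟩ : ∃ k : ℕ, ∫⁻ x, h x ∂μ ≤ ∫⁻ x, min (h x) k ∂μ + η / 2 := by
    by_cases h0 : ∫⁻ x, h x ∂μ = 0
    · exact ⟨0, by rw [h0]; exact zero_le⟩
    have hlt : ∫⁻ x, h x ∂μ - η / 2 < ∫⁻ x, h x ∂μ := ENNReal.sub_lt_self hfin h0 hη2
    conv_rhs at hlt => rw [hsup]
    obtain ⟨k, hk⟩ := lt_iSup_iff.1 hlt
    exact ⟨k, tsub_le_iff_right.1 hk.le⟩
  have hkfin : ∫⁻ x, min (h x) k ∂μ ≠ ⊤ :=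
    ((lintegral_mono fun x => min_le_left _ _).trans_lt hfin.lt_top).ne
  have hrest : ∫⁻ x, (h x - min (h x) k) ∂μ ≤ η / 2 := by
    rw [lintegral_sub (hmk k) hkfin (Eventually.of_forall fun x => min_le_left _ _)]
    exact tsub_le_iff_left.2 hk
  have hη2r : 0 < (η / 2).toReal := ENNReal.toReal_pos hη2
    (ENNReal.div_lt_top hηtop (by norm_num)).ne
  refine ⟨(η / 2).toReal / (k + 1), by positivity, fun e he hmass => ?_⟩
  calc ∫⁻ x, h x ∂e = ∫⁻ x, (h x - min (h x) k) + min (h x) k ∂e :=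
        lintegral_congr fun x => (tsub_add_cancel_of_le (min_le_left _ _)).symm
    _ = ∫⁻ x, (h x - min (h x) k) ∂e + ∫⁻ x, min (h x) k ∂e := lintegral_add_right _ (hmk k)
    _ ≤ η / 2 + η / 2 := by
        refine add_le_add ((lintegral_mono' he le_rfl).trans hrest) ?_
        calc _ ≤ ∫⁻ _, (k : ℝ≥0∞) ∂e := lintegral_mono fun x => min_le_right _ _
          _ = k * e Set.univ := lintegral_const _
          _ ≤ ENNReal.ofReal k * ENNReal.ofReal ((η / 2).toReal / (k + 1)) := by
              rw [ENNReal.ofReal_natCast]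
              gcongr
          _ = ENNReal.ofReal (k * ((η / 2).toReal / (k + 1))) :=
              (ENNReal.ofReal_mul (Nat.cast_nonneg k)).symm
          _ ≤ ENNReal.ofReal (η / 2).toReal := by
              refine ENNReal.ofReal_le_ofReal ?_
              rw [mul_div_assoc', div_le_iff₀ (by positivity)]
              nlinarith
          _ = η / 2 := ENNReal.ofReal_toReal (ENNReal.div_lt_top hηtop (by norm_num)).ne
    _ = η := ENNReal.add_halves η

section

variable {X : Type*} [MetricSpace X] {N : ℕ} {f : ℝ → ℝ}

/-- The compensated cost is uniformly continuous on bounded sets away from the diagonals. -/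
theorem IsRepulsive.exists_compCost_le_add (hf : IsRepulsive f) (o : X) {α R η : ℝ} (hα : 0 < α)
    (hη : 0 < η) :
    ∃ ε : ℝ, 0 < ε ∧ ∀ x y : Fin N → X, (∀ i j, i ≠ j → α ≤ dist (x i) (x j)) →
      (∀ i j, i ≠ j → α ≤ dist (y i) (y j)) → (∀ i, dist (x i) o ≤ R) → (∀ i, dist (y i) o ≤ R) →
      (∀ i, dist (x i) (y i) < ε) → compCost f o x ≤ compCost f o y + ENNReal.ofReal η := by
  set P : Finset (Fin N × Fin N) := Finset.univ.filter fun p => p.1 < p.2 with hP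
  set θ : ℝ := η / (3 * (P.card + 1)) with hθ
  have hθ0 : 0 < θ := by positivity
  have h1 : UniformContinuousOn f (Set.Icc α (2 * R)) :=
    isCompact_Icc.uniformContinuousOn_of_continuous
      (hf.continuousOn.mono fun t ht => hα.trans_le ht.1)
  have h2 : UniformContinuousOn (negTail f) (Set.Icc 0 (2 * R)) :=
    isCompact_Icc.uniformContinuousOn_of_continuous hf.continuous_negTail.continuousOn
  obtain ⟨ε₁, hε₁, h1⟩ := Metric.uniformContinuousOn_iff.1 h1 θ hθ0
  obtain ⟨ε₂, hε₂, h2⟩ := Metric.uniformContinuousOn_iff.1 h2 θ hθ0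
  refine ⟨min (ε₁ / 2) (ε₂ / 2), by positivity, fun x y hx hy hxR hyR hxy => ?_⟩
  have hpair : ∀ p ∈ P, compPair f o (x p.1) (x p.2) ≤
      compPair f o (y p.1) (y p.2) + ENNReal.ofReal (3 * θ) := by
    intro p hp
    have hne : p.1 ≠ p.2 := (Finset.mem_filter.1 hp).2.ne
    have hx0 := hx _ _ hne
    have hy0 := hy _ _ hne
    have hxd : dist (x p.1) (x p.2) ≠ 0 := (hα.trans_le hx0).ne'
    have hyd : dist (y p.1) (y p.2) ≠ 0 := (hα.trans_le hy0).ne'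
    have hle : ∀ z : Fin N → X, (∀ i, dist (z i) o ≤ R) → dist (z p.1) (z p.2) ≤ 2 * R := by
      intro z hz
      have := dist_triangle_right (z p.1) (z p.2) o
      linarith [hz p.1, hz p.2]
    have hd1 : dist (x p.1) (y p.1) < ε₁ / 2 := (hxy _).trans_le (min_le_left _ _)
    have hd2 : dist (x p.2) (y p.2) < ε₁ / 2 := (hxy _).trans_le (min_le_left _ _)
    have hf1 : dist (f (dist (x p.1) (x p.2))) (f (dist (y p.1) (y p.2))) < θ := by
      refine h1 _ ⟨hx0, hle x hxR⟩ _ ⟨hy0, hle y hyR⟩ ?_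
      have := dist_dist_dist_le (x p.1) (x p.2) (y p.1) (y p.2)
      linarith
    have hw : ∀ i, dist (tailWeight f o (x i)) (tailWeight f o (y i)) < θ := by
      intro i
      refine h2 _ ⟨by positivity, by linarith [hxR i]⟩ _ ⟨by positivity, by linarith [hyR i]⟩ ?_
      have h3 := dist_dist_dist_le (x i) o (y i) o
      have h4 : dist (x i) (y i) < ε₂ / 2 := (hxy i).trans_le (min_le_right _ _)
      rw [dist_self, add_zero, Real.dist_eq] at h3
      rw [Real.dist_eq, ← mul_sub, abs_mul, abs_two]
      linarith
    unfold compPair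
    rw [if_neg hxd, if_neg hyd, ← ENNReal.ofReal_add (hf.add_tailWeight_nonneg o hyd)
      (by positivity)]
    refine ENNReal.ofReal_le_ofReal ?_
    have e1 := (abs_lt.1 (Real.dist_eq _ _ ▸ hf1)).2
    have e2 := (abs_lt.1 (Real.dist_eq _ _ ▸ hw p.1)).2
    have e3 := (abs_lt.1 (Real.dist_eq _ _ ▸ hw p.2)).2
    linarith
  calc compCost f o x ≤ ∑ p ∈ P, (compPair f o (y p.1) (y p.2) + ENNReal.ofReal (3 * θ)) :=
        Finset.sum_le_sum hpair
    _ = compCost f o y + P.card * ENNReal.ofReal (3 * θ) := by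
        rw [Finset.sum_add_distrib, Finset.sum_const, nsmul_eq_mul]; rfl
    _ ≤ _ := by
        gcongr
        rw [← ENNReal.ofReal_natCast, ← ENNReal.ofReal_mul (Nat.cast_nonneg _)]
        refine ENNReal.ofReal_le_ofReal ?_
        rw [hθ]
        rw [show (P.card : ℝ) * (3 * (η / (3 * (P.card + 1)))) = P.card * η / (P.card + 1) by
          field_simp]
        rw [div_le_iff₀ (by positivity)]
        nlinarith

/-- Away from the diagonals the compensated cost is at most a constant plus the compensation. -/
theorem IsRepulsive.compCost_le (hf : IsRepulsive f) (o : X) {r : ℝ} (hr : 0 < r) {x : Fin N → X}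
    (hx : ∀ i j, i ≠ j → r ≤ dist (x i) (x j)) :
    compCost f o x ≤ ((Finset.univ.filter fun p : Fin N × Fin N => p.1 < p.2).card : ℝ≥0∞) *
      ENNReal.ofReal |f r| + compensation f o x := by
  unfold compCost compensation
  rw [← nsmul_eq_mul, ← Finset.sum_const, ← Finset.sum_add_distrib]
  refine Finset.sum_le_sum fun p hp => ?_
  have h := hx _ _ (Finset.mem_filter.1 hp).2.ne
  have hpos := hr.trans_le h
  have h1 : 0 ≤ tailWeight f o (x p.1) := negTail_nonneg _ _
  have h2 : 0 ≤ tailWeight f o (x p.2) := negTail_nonneg _ _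
  unfold compPair
  rw [if_neg hpos.ne', ← ENNReal.ofReal_add h1 h2, ← ENNReal.ofReal_add (abs_nonneg _)
    (add_nonneg h1 h2)]
  refine ENNReal.ofReal_le_ofReal ?_
  have := hf.antitoneOn (Set.mem_Ioi.2 hr) (Set.mem_Ioi.2 hpos) h
  linarith [le_abs_self (f r)]

end

/-! ### Masses of the cells and of the remote tuples -/

section Labels

variable {X : Type*} [MeasurableSpace X] {N : ℕ} {L : Type*} [Fintype L] [MeasurableSpace L]
  [DiscreteMeasurableSpace L]

theorem sum_ite_measureReal_fiber (μ : Measure X) [IsFiniteMeasure μ] {ℓ : X → L}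
    (hℓ : Measurable ℓ) (Q : L → Prop) [DecidablePred Q] :
    ∑ l, (if Q l then μ.real (ℓ ⁻¹' {l}) else 0) = μ.real {x | Q (ℓ x)} := by
  rw [← Finset.sum_filter, ← measureReal_biUnion_finset]
  · congr 1
    ext x
    simp
  · intro l _ l' _ hll'
    refine Set.disjoint_left.2 fun x hx hx' => hll' ?_
    rw [← Set.mem_singleton_iff.1 hx, ← Set.mem_singleton_iff.1 hx']
  · exact fun l _ => hℓ (measurableSet_singleton l)

omit [MeasurableSpace X] [Fintype L] [MeasurableSpace L] [DiscreteMeasurableSpace L] in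
theorem cell_eq_preimage (ℓ : X → L) (k : Fin N → L) :
    cell ℓ k = (fun (x : Fin N → X) i => ℓ (x i)) ⁻¹' {k} := by
  ext x
  rw [mem_cell, Set.mem_preimage, Set.mem_singleton_iff, funext_iff]

/-- The masses of the cells under a coupling of `μ` have the marginals of `μ`. -/
theorem IsCoupling.sum_cell_mul {μ : Measure X} [IsProbabilityMeasure μ]
    {γ : ProbabilityMeasure (Fin N → X)} (hγ : IsCoupling μ γ) {ℓ : X → L} (hℓ : Measurable ℓ)
    (j : Fin N) (φ : L → ℝ) :
    ∑ k, (γ : Measure (Fin N → X)).real (cell ℓ k) * φ (k j) =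
      ∑ l, μ.real (ℓ ⁻¹' {l}) * φ l := by
  classical
  have h1 : ∀ k : Fin N → L, (γ : Measure (Fin N → X)).real (cell ℓ k) * φ (k j) =
      ∑ l, (if k j = l then (γ : Measure (Fin N → X)).real (cell ℓ k) else 0) * φ l := by
    intro k
    simp [ite_mul]
  simp_rw [h1]
  rw [Finset.sum_comm]
  refine Finset.sum_congr rfl fun l _ => ?_
  rw [← Finset.sum_mul]
  congr 1
  have hm : Measurable fun (x : Fin N → X) i => ℓ (x i) :=
    measurable_pi_lambda _ fun i => hℓ.comp (measurable_pi_apply i)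
  have h2 := sum_ite_measureReal_fiber (γ : Measure (Fin N → X)) hm fun k => k j = l
  simp_rw [← cell_eq_preimage] at h2
  have h3 : (γ : Measure (Fin N → X)).real {x | ℓ (x j) = l} = μ.real (ℓ ⁻¹' {l}) := by
    rw [← hγ j, measureReal_def, measureReal_def, Measure.map_apply (measurable_pi_apply j)
      (hℓ (measurableSet_singleton l))]
    rfl
  rw [← h3, ← h2]

omit [Fintype L] in
theorem measureReal_cell_perm {γ : ProbabilityMeasure (Fin N → X)} (σ : Equiv.Perm (Fin N))
    (hγ : (γ : Measure (Fin N → X)).map (fun x => x ∘ σ) = γ) {ℓ : X → L} (hℓ : Measurable ℓ)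
    (k : Fin N → L) : (γ : Measure (Fin N → X)).real (cell ℓ (k ∘ σ)) =
      (γ : Measure (Fin N → X)).real (cell ℓ k) := by
  have hm : Measurable fun x : Fin N → X => x ∘ σ :=
    measurable_pi_lambda _ fun i => measurable_pi_apply _
  conv_lhs => rw [← hγ]
  rw [measureReal_def, Measure.map_apply hm (measurableSet_cell hℓ _), measureReal_def]
  congr 2
  ext x
  simp only [Set.mem_preimage, mem_cell, Function.comp]
  exact ⟨fun h i => by simpa using h (σ⁻¹ i), fun h i => h (σ i)⟩

omit [MeasurableSpace L] [DiscreteMeasurableSpace L] in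
theorem sum_ofReal_mul {μ : Measure X} [IsProbabilityMeasure μ] {ℓ : X → L} {w : (Fin N → L) → ℝ}
    (hw : ∀ k, 0 ≤ w k) {j : Fin N}
    (h : ∀ φ : L → ℝ, ∑ k, w k * φ (k j) = ∑ l, μ.real (ℓ ⁻¹' {l}) * φ l) (φ : L → ℝ≥0∞) :
    ∑ k, ENNReal.ofReal (w k) * φ (k j) = ∑ l, μ (ℓ ⁻¹' {l}) * φ l := by
  classical
  have h1 : ∀ k : Fin N → L, ENNReal.ofReal (w k) * φ (k j) =
      ∑ l, (if k j = l then ENNReal.ofReal (w k) else 0) * φ l := by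
    intro k
    simp [ite_mul]
  simp_rw [h1]
  rw [Finset.sum_comm]
  refine Finset.sum_congr rfl fun l _ => ?_
  rw [← Finset.sum_mul]
  congr 1
  have h2 := h fun l' => if l' = l then 1 else 0
  simp only [mul_ite, mul_one, mul_zero, Finset.sum_ite_eq', Finset.mem_univ, if_true] at h2
  rw [← ofReal_measureReal (measure_ne_top μ _), ← h2, ENNReal.ofReal_sum_of_nonneg]
  · refine Finset.sum_congr rfl fun k _ => ?_
    split_ifs <;> simp
  · intro k _
    split_ifs <;> simp [hw]

omit [MeasurableSpace L] [DiscreteMeasurableSpace L] in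
theorem fiber_ne_zero_of_weight_ne_zero {μ : Measure X} {ℓ : X → L} {W : (Fin N → L) → ℝ≥0∞}
    (hW : ∀ (j : Fin N) (φ : L → ℝ≥0∞), ∑ k, W k * φ (k j) = ∑ l, μ (ℓ ⁻¹' {l}) * φ l)
    (k : Fin N → L) (hk : W k ≠ 0) (i : Fin N) : μ (ℓ ⁻¹' {k i}) ≠ 0 := by
  classical
  intro h0
  have h := hW i fun l => if l = k i then 1 else 0
  simp only [mul_ite, mul_one, mul_zero, Finset.sum_ite_eq', Finset.mem_univ, if_true, h0] at h
  have := (Finset.sum_eq_zero_iff.1 h) k (Finset.mem_univ k)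
  simp [hk] at this

end Labels

section

variable {X : Type*} [MetricSpace X] {N : ℕ} [MeasurableSpace X]

/-- The quantitative content of condition (A): at some scale `r`, the union bound over the
`N² (N - 1) / 2` pairs of entries of the regrouped tuples leaves a positive probability. -/
theorem ConditionA.exists_radius {μ : Measure X} (hA : ConditionA N μ) (hN : 2 ≤ N) :
    ∃ r κ : ℝ, 0 < r ∧ 0 ≤ κ ∧ (∀ z, μ (Metric.ball z (4 * r)) ≤ ENNReal.ofReal κ) ∧
      (N : ℝ) ^ 2 * ((N : ℝ) - 1) / 2 * κ < 1 := by
  obtain ⟨l, hl, hlt⟩ := hA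
  have hev := (hl.eventually_lt_const hlt).and self_mem_nhdsWithin
  obtain ⟨s, hs, hs0⟩ := hev.exists
  have hs0 : 0 < s := hs0
  have hN' : (2 : ℝ) ≤ N := by exact_mod_cast hN
  have htop := (hs.trans ENNReal.ofReal_lt_top).ne
  refine ⟨s / 4, (⨆ x : X, μ (Metric.ball x s)).toReal, by positivity, ENNReal.toReal_nonneg,
    fun z => ?_, ?_⟩
  · rw [ENNReal.ofReal_toReal htop, mul_div_cancel₀ _ (by norm_num : (4 : ℝ) ≠ 0)]
    exact le_iSup (fun x : X => μ (Metric.ball x s)) z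
  · have h1 : (⨆ x : X, μ (Metric.ball x s)).toReal < 1 / ((N : ℝ) * ((N : ℝ) - 1) ^ 2) := by
      rw [← ENNReal.ofReal_lt_ofReal_iff (by have : (0:ℝ) < N - 1 := by linarith
                                             positivity), ENNReal.ofReal_toReal htop]
      exact hs
    have hN1 : (0 : ℝ) < N - 1 := by linarith
    have hc : 0 < (N : ℝ) ^ 2 * ((N : ℝ) - 1) / 2 := by positivity
    refine (mul_lt_mul_of_pos_left h1 hc).trans_le ?_
    rw [mul_one_div, div_le_one (by positivity)]
    nlinarith [mul_pos (by linarith : (0 : ℝ) < N) hN1]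

/-- The tuples that are `α`-close to a diagonal or leave the ball of radius `R`. -/
def remoteSet (N : ℕ) (o : X) (α R : ℝ) : Set (Fin N → X) :=
  {x | (∃ i j, i ≠ j ∧ dist (x i) (x j) < α) ∨ ∃ i, R < dist (x i) o}

variable [BorelSpace X] [SecondCountableTopology X]

omit [MeasurableSpace X] [BorelSpace X] [SecondCountableTopology X] in
theorem isOpen_remoteSet (o : X) (α R : ℝ) : IsOpen (remoteSet N o α R) := by
  have h1 : remoteSet N o α R =
      (⋃ i, ⋃ j, ⋃ _ : i ≠ j, {x : Fin N → X | dist (x i) (x j) < α}) ∪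
        ⋃ i, {x : Fin N → X | R < dist (x i) o} := by
    ext x
    simp [remoteSet]
  rw [h1]
  refine IsOpen.union (isOpen_iUnion fun i => isOpen_iUnion fun j => isOpen_iUnion fun _ => ?_)
    (isOpen_iUnion fun i => ?_)
  · exact isOpen_lt (by fun_prop) continuous_const
  · exact isOpen_lt continuous_const (by fun_prop)

/-- A measure of finite cost does not charge the diagonals, hence charges small neighbourhoods of them
and the complements of large balls arbitrarily little. -/
theorem exists_measure_remoteSet_le {f : ℝ → ℝ} (hf : IsRepulsive f) (o : X)
    {γ : Measure (Fin N → X)} [IsFiniteMeasure γ] (hI : ∫⁻ x, compCost f o x ∂γ ≠ ⊤) {β : ℝ≥0∞}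
    (hβ : 0 < β) : ∃ α R : ℝ, 0 < α ∧ γ (remoteSet N o α R) ≤ β := by
  have htend : Tendsto (fun n : ℕ => γ (remoteSet N o (1 / ((n : ℝ) + 1)) n)) atTop
      (𝓝 (γ (⋂ n : ℕ, remoteSet N o (1 / ((n : ℝ) + 1)) n))) := by
    refine tendsto_measure_iInter_atTop
      (fun n => (isOpen_remoteSet o _ _).measurableSet.nullMeasurableSet) (fun n n' hn => ?_)
      ⟨0, measure_ne_top _ _⟩
    rintro x (⟨i, j, hij, h⟩ | ⟨i, h⟩)
    · exact Or.inl ⟨i, j, hij, h.trans_le (Nat.one_div_le_one_div hn)⟩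
    · exact Or.inr ⟨i, lt_of_le_of_lt (by exact_mod_cast hn) h⟩
  have hzero : γ (⋂ n : ℕ, remoteSet N o (1 / ((n : ℝ) + 1)) n) = 0 := by
    have hae := ae_lt_top (hf.continuous_compCost (N := N) o).measurable hI
    refine measure_mono_null (fun x hx => ?_) hae
    simp only [Set.mem_iInter] at hx
    change ¬ compCost f o x < ⊤
    rw [not_lt_top_iff]
    -- a tuple with two equal entries has infinite cost
    by_contra hfin
    have hdist : ∀ i j, i ≠ j → 0 < dist (x i) (x j) := by
      intro i j hij
      by_contra h0
      apply hfin
      have h0 : dist (x i) (x j) = 0 := le_antisymm (not_lt.1 h0) dist_nonneg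
      unfold compCost
      rw [ENNReal.sum_eq_top]
      rcases lt_or_gt_of_ne hij with h | h
      · exact ⟨(i, j), by simp [h], if_pos h0⟩
      · exact ⟨(j, i), by simp [h], if_pos (by rw [dist_comm]; exact h0)⟩
    have hev : ∀ᶠ n : ℕ in atTop, x ∉ remoteSet N o (1 / ((n : ℝ) + 1)) n := by
      have h1 : ∀ᶠ n : ℕ in atTop, ∀ i j, i ≠ j → 1 / ((n : ℝ) + 1) < dist (x i) (x j) := by
        rw [eventually_all]; intro i
        rw [eventually_all]; intro j
        by_cases hij : i = j
        · exact Eventually.of_forall fun n h => absurd hij h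
        · filter_upwards [tendsto_one_div_add_atTop_nhds_zero_nat.eventually_lt_const
            (hdist i j hij)] with n hn _ using hn
      have h2 : ∀ᶠ n : ℕ in atTop, ∀ i, dist (x i) o ≤ n := by
        rw [eventually_all]; intro i
        exact tendsto_natCast_atTop_atTop.eventually_ge_atTop _
      filter_upwards [h1, h2] with n h1 h2
      rintro (⟨i, j, hij, h⟩ | ⟨i, h⟩)
      · exact absurd h (h1 i j hij).not_gt
      · exact absurd h (not_lt.2 (h2 i))
    obtain ⟨n, hn⟩ := hev.exists
    exact hn (hx n)
  rw [hzero] at htend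
  obtain ⟨n, hn⟩ := (htend.eventually_lt_const hβ).exists
  exact ⟨_, _, by positivity, hn.le⟩

omit [SecondCountableTopology X] in
/-- Cost of a small measure living on separated tuples. -/
theorem lintegral_compCost_le_of_separated {f : ℝ → ℝ} (hf : IsRepulsive f) (o : X)
    {r : ℝ} (hr : 0 < r) {b : Measure (Fin N → X)} (hb : b (nearDiagonal X N r) = 0) {ζ : ℝ≥0∞}
    (hζ : ∀ i, ∫⁻ x, ENNReal.ofReal (tailWeight f o x) ∂(b.map fun x => x i) ≤ ζ) :
    ∫⁻ x, compCost f o x ∂b ≤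
      ((Finset.univ.filter fun p : Fin N × Fin N => p.1 < p.2).card : ℝ≥0∞) *
        (ENNReal.ofReal |f r| * b Set.univ + (ζ + ζ)) := by
  have hm := hf.measurable_tailWeight o
  have hae : ∀ᵐ x ∂b, ∀ i j, i ≠ j → r ≤ dist (x i) (x j) := by
    refine measure_mono_null (fun x hx => ?_) hb
    simp only [Set.mem_compl_iff, Set.mem_ofPred_eq, not_forall, not_le] at hx
    obtain ⟨i, j, hij, h⟩ := hx
    exact ⟨i, j, hij, h⟩
  calc _ ≤ ∫⁻ x, (((Finset.univ.filter fun p : Fin N × Fin N => p.1 < p.2).card : ℝ≥0∞) *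
        ENNReal.ofReal |f r| + compensation f o x) ∂b := by
        refine lintegral_mono_ae ?_
        filter_upwards [hae] with x hx using hf.compCost_le o hr hx
    _ = ((Finset.univ.filter fun p : Fin N × Fin N => p.1 < p.2).card : ℝ≥0∞) *
        ENNReal.ofReal |f r| * b Set.univ + ∫⁻ x, compensation f o x ∂b := by
        rw [lintegral_add_left measurable_const, lintegral_const]
    _ ≤ _ := by
        rw [mul_add, mul_assoc]
        gcongr
        unfold compensation
        rw [lintegral_finsetSum, ← nsmul_eq_mul, ← Finset.sum_const]
        · refine Finset.sum_le_sum fun p _ => ?_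
          rw [lintegral_add_left (f := fun x : Fin N → X => ENNReal.ofReal (tailWeight f o (x p.1)))
            (hm.comp (measurable_pi_apply _))]
          refine add_le_add ?_ ?_
          · rw [← lintegral_map hm (measurable_pi_apply p.1)]; exact hζ _
          · rw [← lintegral_map hm (measurable_pi_apply p.2)]; exact hζ _
        · intro p _
          exact (hm.comp (measurable_pi_apply _)).add (hm.comp (measurable_pi_apply _))

end

/-! ### Block approximation of couplings -/

section

variable {X : Type*} [MetricSpace X] {N : ℕ} [MeasurableSpace X]
variable [BorelSpace X] [SecondCountableTopology X]

omit [BorelSpace X] [SecondCountableTopology X] in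
open Classical in
/-- The measure-theoretic form of the rearrangement: given a labelling at two scales, a symmetric
coupling `γ` is replaced by the block measure with weights `g₀ + e`, where `g₀` is dominated by the
masses that `γ` gives to the good cells and `e` is small and carried by separated cells. -/
theorem exists_block_weights [NeZero N] {μ : Measure X} [IsProbabilityMeasure μ] {γ : SymProb X N}
    (hγ : IsCoupling μ γ.1) {r κ ε δ z : ℝ} (hκ : 0 ≤ κ)
    (hball : ∀ y, μ (Metric.ball y (4 * r)) ≤ ENNReal.ofReal κ) (hεr : ε ≤ r)
    {P : ℕ} {ℓ : X → Bool × Fin (P + 1)} {Fine : Bool × Fin (P + 1) → Prop} (hℓ : Measurable ℓ)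
    (hdiam : ∀ x y, ℓ x = ℓ y → Fine (ℓ x) → dist x y < ε)
    (hcells : ∀ l, (∃ z, ∀ x, ℓ x = l → dist x z < 2 * r) ∨
      ∀ x y, ℓ x = l → Fine (ℓ y) → r ≤ dist x y)
    {S : Set (Fin N → X)} (hSσ : ∀ (σ : Equiv.Perm (Fin N)) x, x ∘ σ ∈ S → x ∈ S)
    (hbad : (γ.1 : Measure (Fin N → X)).real {x | x ∈ S ∨ ∃ i, ¬ Fine (ℓ (x i))} ≤ δ)
    (hδ1 : δ ≤ 1) (hz0 : 0 < z)
    (hz : z ≤ (1 - δ) ^ (N - 1) - (N : ℝ) ^ 2 * ((N : ℝ) - 1) / 2 * κ)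
    (hδz : ((N : ℝ) - 1) * δ ≤ z) :
    ∃ g₀ e : (Fin N → Bool × Fin (P + 1)) → ℝ, (∀ k, 0 ≤ g₀ k) ∧ (∀ k, 0 ≤ e k) ∧
      (∀ k, g₀ k ≤ (γ.1 : Measure (Fin N → X)).real (cell ℓ k)) ∧
      (∀ k, g₀ k ≠ 0 → (∀ i, Fine (k i)) ∧ ∃ x ∈ cell ℓ k, x ∉ S) ∧
      (∀ k, e k ≠ 0 → ∀ x ∈ cell ℓ k, ∀ i j, i ≠ j → r ≤ dist (x i) (x j)) ∧
      ∑ k, e k ≤ N * δ ∧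
      (∀ (j : Fin N) (φ : Bool × Fin (P + 1) → ℝ),
        ∑ k, (g₀ k + e k) * φ (k j) = ∑ l, μ.real (ℓ ⁻¹' {l}) * φ l) ∧
      ∀ (σ : Equiv.Perm (Fin N)) k, g₀ (k ∘ σ) = g₀ k ∧ e (k ∘ σ) = e k := by
  have hm : Measurable fun (x : Fin N → X) i => ℓ (x i) :=
    measurable_pi_lambda _ fun i => hℓ.comp (measurable_pi_apply i)
  set sep : Bool × Fin (P + 1) → Bool × Fin (P + 1) → Prop :=
    fun l l' => ∀ x x', ℓ x = l → ℓ x' = l' → r ≤ dist x x' with hsep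
  set Good : (Fin N → Bool × Fin (P + 1)) → Prop :=
    fun k => (∀ i, Fine (k i)) ∧ ∃ x ∈ cell ℓ k, x ∉ S with hGood
  have hsum : ∀ Q : (Fin N → Bool × Fin (P + 1)) → Prop,
      ∑ k, (if Q k then (γ.1 : Measure (Fin N → X)).real (cell ℓ k) else 0) =
        (γ.1 : Measure (Fin N → X)).real {x | Q fun i => ℓ (x i)} := by
    intro Q
    simp_rw [cell_eq_preimage]
    exact sum_ite_measureReal_fiber (γ.1 : Measure (Fin N → X)) hm Q
  have hclose : ∀ l, ∑ l', (if Fine l' ∧ ¬ sep l l' then μ.real (ℓ ⁻¹' {l'}) else 0) ≤ κ := by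
    intro l
    refine (le_of_eq (sum_ite_measureReal_fiber μ hℓ fun l' => Fine l' ∧ ¬ sep l l')).trans ?_
    rcases hcells l with ⟨y₀, hy₀⟩ | hfar
    · refine ENNReal.toReal_le_of_le_ofReal hκ ((measure_mono fun y hy => ?_).trans (hball y₀))
      obtain ⟨hy, hns⟩ := hy
      simp only [hsep, not_forall, not_le] at hns
      obtain ⟨x, x', hx, hx', hlt⟩ := hns
      have h1 := hdiam y x' hx'.symm hy
      have h2 := hy₀ x hx
      rw [Metric.mem_ball]
      have h3 := dist_triangle4_left y y₀ x' x
      have h4 := dist_comm x' y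
      have h5 := dist_triangle4 y x' x y₀
      rw [dist_comm x' x] at h5
      linarith
    · have : {y | Fine (ℓ y) ∧ ¬ sep l (ℓ y)} = ∅ := by
        rw [Set.eq_empty_iff_forall_notMem]
        rintro y ⟨hy, hns⟩
        refine hns fun x x' hx hx' => hfar x x' hx (hx' ▸ hy)
      rw [this, measureReal_empty]
      exact hκ
  -- `Good` unfolds to a conjunction, whose default decidability instance is not the classical one
  have hmass : ∑ k, @ite ℝ (Good k) (Classical.propDecidable _) 0
      ((γ.1 : Measure (Fin N → X)).real (cell ℓ k)) ≤ δ := by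
    have h1 : ∑ k, @ite ℝ (Good k) (Classical.propDecidable _) 0
        ((γ.1 : Measure (Fin N → X)).real (cell ℓ k)) =
        (γ.1 : Measure (Fin N → X)).real {x | ¬ Good fun i => ℓ (x i)} := by
      rw [← hsum fun k => ¬ Good k]
      refine Finset.sum_congr rfl fun k _ => ?_
      by_cases h : Good k <;> simp [h]
    rw [h1]
    refine (measureReal_mono fun x hx => ?_).trans hbad
    by_contra hn
    simp only [Set.mem_ofPred_eq, not_or, not_exists, not_not] at hn
    exact hx ⟨hn.2, x, mem_cell_self ℓ x, hn.1⟩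
  obtain ⟨g₀, e, hg₀, he, hle, hes, hem, hmar, hσ⟩ := exists_symmetric_rearrangement sep
    (fun l l' h x x' hx hx' => by rw [dist_comm]; exact h x' x hx' hx)
    (fun l => μ.real (ℓ ⁻¹' {l})) (fun k => (γ.1 : Measure (Fin N → X)).real (cell ℓ k))
    (fun k => measureReal_nonneg) (by simpa using hsum fun _ => True)
    (fun j φ => hγ.sum_cell_mul hℓ j φ)
    (fun σ k => measureReal_cell_perm σ (γ.2 σ) hℓ k) Good
    (fun σ k hk => ⟨fun i => hk.1 (σ i), by
      obtain ⟨x, hx, hxS⟩ := hk.2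
      refine ⟨x ∘ σ, mem_cell.2 fun i => mem_cell.1 hx (σ i), fun h => hxS (hSσ σ x h)⟩⟩)
    Fine (fun k hk => hk.1) hκ (δ := δ) (z := z) hclose hmass hδ1 hz0 hz hδz
  refine ⟨g₀, e, hg₀, he, fun k => ?_, fun k hk => ?_, fun k hk x hx i j hij => ?_, hem, hmar, hσ⟩
  · refine (hle k).trans ?_
    split_ifs
    · exact le_rfl
    · exact measureReal_nonneg
  · by_contra hn
    have h1 := hle k
    rw [if_neg hn] at h1
    exact hk (le_antisymm h1 (hg₀ k))
  · exact hes k hk i j hij _ _ (mem_cell.1 hx i) (mem_cell.1 hx j)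

/-- The approximation behind the recovery sequence: a symmetric coupling of finite cost is
approximated by symmetric block couplings that avoid a neighbourhood of the diagonals, with almost
the same cost. -/
theorem exists_block_approximation (hN : 2 ≤ N) {μ : Measure X} [IsProbabilityMeasure μ]
    (hA : ConditionA N μ) {f : ℝ → ℝ} (hf : IsRepulsive f) {o : X}
    (hμ : ∫⁻ x, ENNReal.ofReal (tailWeight f o x) ∂μ ≠ ⊤) {γ : SymProb X N}
    (hγ : IsCoupling μ γ.1)
    (hI : ∫⁻ x, compCost f o x ∂(γ.1 : Measure (Fin N → X)) ≠ ⊤) {η : ℝ} (hη : 0 < η) :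
    ∃ γ' : SymProb X N, IsCoupling μ γ'.1 ∧ IsBlock γ'.1 ∧
      (∃ C : ℝ, 0 < C ∧ (γ'.1 : Measure (Fin N → X)) ≤
        ENNReal.ofReal C • Measure.pi fun _ => μ) ∧
      (∃ α : ℝ, 0 < α ∧ (γ'.1 : Measure (Fin N → X)) (nearDiagonal X N α) = 0) ∧
      ∫⁻ x, compCost f o x ∂(γ'.1 : Measure (Fin N → X)) ≤
        ∫⁻ x, compCost f o x ∂(γ.1 : Measure (Fin N → X)) + ENNReal.ofReal η ∧
      ∀ F : Set (Fin N → X), MeasurableSet F → (γ'.1 : Measure (Fin N → X)) F ≤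
        (γ.1 : Measure (Fin N → X)) (Metric.thickening η F) + ENNReal.ofReal η := by
  have : NeZero N := ⟨by omega⟩
  have hN' : (2 : ℝ) ≤ N := by exact_mod_cast hN
  have hN0 : (0 : ℝ) < N := by linarith
  obtain ⟨r, κ, hr, hκ, hball, hκ1⟩ := hA.exists_radius hN
  set θ : ℝ := 1 - (N : ℝ) ^ 2 * ((N : ℝ) - 1) / 2 * κ with hθ
  have hθ0 : 0 < θ := by linarith
  set c : ℕ := (Finset.univ.filter fun p : Fin N × Fin N => p.1 < p.2).card with hc
  -- `ζ` bounds the tails of the small part, `δ` the mass of the bad tuples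
  set ζ : ℝ := η / (8 * (c + 1)) with hζ
  have hζ0 : 0 < ζ := by positivity
  obtain ⟨δ', hδ'0, hδ'⟩ := exists_forall_lintegral_le (hf.measurable_tailWeight o) hμ
    (η := ENNReal.ofReal ζ) (by simpa using hζ0)
  obtain ⟨δ, hδ0, hδ1, hδθ, hδη, hδδ', hδc⟩ : ∃ δ : ℝ, 0 < δ ∧ δ ≤ 1 ∧ ((N : ℝ) - 1) * δ ≤ θ / 2 ∧
      N * δ ≤ η ∧ N * δ ≤ δ' ∧ c * (|f r| * (N * δ)) ≤ η / 4 := by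
    set B : ℝ := (c + 1) * (|f r| + 1) * N with hB
    have hB0 : 0 < B := by positivity
    refine ⟨min 1 (min (θ / (2 * N)) (min (η / N) (min (δ' / N) (η / (4 * B))))),
      by positivity, min_le_left _ _, ?_, ?_, ?_, ?_⟩
    · have h : min 1 (min (θ / (2 * N)) (min (η / N) (min (δ' / N) (η / (4 * B))))) ≤
        θ / (2 * N) := (min_le_right _ _).trans (min_le_left _ _)
      calc _ ≤ ((N : ℝ) - 1) * (θ / (2 * N)) := mul_le_mul_of_nonneg_left h (by linarith)
        _ ≤ N * (θ / (2 * N)) := mul_le_mul_of_nonneg_right (by linarith) (by positivity)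
        _ = θ / 2 := by field_simp
    · have h : min 1 (min (θ / (2 * N)) (min (η / N) (min (δ' / N) (η / (4 * B))))) ≤ η / N :=
        (min_le_right _ _).trans ((min_le_right _ _).trans (min_le_left _ _))
      rw [mul_comm]
      exact (le_div_iff₀ hN0).1 h
    · have h : min 1 (min (θ / (2 * N)) (min (η / N) (min (δ' / N) (η / (4 * B))))) ≤ δ' / N :=
        (min_le_right _ _).trans ((min_le_right _ _).trans
          ((min_le_right _ _).trans (min_le_left _ _)))
      rw [mul_comm]
      exact (le_div_iff₀ hN0).1 h
    · have h : min 1 (min (θ / (2 * N)) (min (η / N) (min (δ' / N) (η / (4 * B))))) ≤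
        η / (4 * B) := (min_le_right _ _).trans ((min_le_right _ _).trans
          ((min_le_right _ _).trans (min_le_right _ _)))
      have hcB : c * (|f r| * N) ≤ B := by
        rw [hB, mul_assoc]
        have h1 : (c : ℝ) ≤ c + 1 := by linarith
        have h2 : |f r| * N ≤ (|f r| + 1) * N := by nlinarith
        exact mul_le_mul h1 h2 (by positivity) (by positivity)
      calc _ = c * (|f r| * N) *
            min 1 (min (θ / (2 * N)) (min (η / N) (min (δ' / N) (η / (4 * B))))) := by ring
        _ ≤ B * (η / (4 * B)) := mul_le_mul hcB h (by positivity) hB0.le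
        _ = η / 4 := by field_simp
  obtain ⟨α, R, hα, hS⟩ := exists_measure_remoteSet_le hf o hI
    (β := ENNReal.ofReal (δ / 2)) (by simpa using hδ0)
  obtain ⟨ε₀, hε₀, hunif⟩ := hf.exists_compCost_le_add (N := N) o (R := R + 1) (half_pos hα)
    (half_pos hη)
  set ε : ℝ := min (min ε₀ (α / 4)) (min (min 1 r) η) with hε
  have hε0 : 0 < ε := by positivity
  have hεε₀ : ε ≤ ε₀ := (min_le_left _ _).trans (min_le_left _ _)
  have hεα : ε ≤ α / 4 := (min_le_left _ _).trans (min_le_right _ _)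
  have hε1 : ε ≤ 1 := (min_le_right _ _).trans ((min_le_left _ _).trans (min_le_left _ _))
  have hεr : ε ≤ r := (min_le_right _ _).trans ((min_le_left _ _).trans (min_le_right _ _))
  have hεη : ε ≤ η := (min_le_right _ _).trans (min_le_right _ _)
  obtain ⟨P, ℓ, Fine, hℓ, hdiam, hcells, hfine⟩ := exists_labelling μ hr hε0 hεr
    (δ := ENNReal.ofReal (δ / (2 * N))) (by simp only [ENNReal.ofReal_pos]; positivity)
  have hbad : (γ.1 : Measure (Fin N → X)).real
      {x | x ∈ remoteSet N o α R ∨ ∃ i, ¬ Fine (ℓ (x i))} ≤ δ := by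
    refine ENNReal.toReal_le_of_le_ofReal hδ0.le ?_
    have h1 : {x | x ∈ remoteSet N o α R ∨ ∃ i, ¬ Fine (ℓ (x i))} =
        remoteSet N o α R ∪ ⋃ i, (fun x : Fin N → X => x i) ⁻¹' {y | ¬ Fine (ℓ y)} := by
      ext x; simp
    have hFm : MeasurableSet {y | ¬ Fine (ℓ y)} := hℓ (MeasurableSet.of_discrete (s := {l | ¬ Fine l}))
    rw [h1]
    calc _ ≤ ENNReal.ofReal (δ / 2) + ∑ _i : Fin N, ENNReal.ofReal (δ / (2 * N)) := by
          refine (measure_union_le _ _).trans (add_le_add hS ?_)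
          refine (measure_iUnion_fintype_le _ _).trans (Finset.sum_le_sum fun i _ => ?_)
          rw [← Measure.map_apply (measurable_pi_apply i) hFm, hγ i]
          exact hfine
      _ = ENNReal.ofReal δ := by
          rw [Finset.sum_const, Finset.card_univ, Fintype.card_fin, nsmul_eq_mul,
            ← ENNReal.ofReal_natCast, ← ENNReal.ofReal_mul hN0.le,
            ← ENNReal.ofReal_add (by positivity) (by positivity)]
          congr 1
          field_simp
          ring
  have hpow : θ / 2 ≤ (1 - δ) ^ (N - 1) - (N : ℝ) ^ 2 * ((N : ℝ) - 1) / 2 * κ := by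
    have h1 := one_add_mul_le_pow (a := -δ) (by linarith) (N - 1)
    rw [Nat.cast_sub (by omega), Nat.cast_one, ← sub_eq_add_neg] at h1
    linarith
  obtain ⟨g₀, e, hg₀, he, hle, hgood, hes, hem, hmar, hσ⟩ := exists_block_weights hγ hκ hball hεr hℓ
    hdiam hcells (S := remoteSet N o α R) (fun σ x hx => by
      rcases hx with ⟨i, j, hij, h⟩ | ⟨i, h⟩
      · exact Or.inl ⟨σ i, σ j, fun h => hij (σ.injective h), h⟩
      · exact Or.inr ⟨σ i, h⟩) hbad hδ1 (half_pos hθ0) hpow hδθ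
  -- the points of the good cells are separated and bounded
  have hgoodcell : ∀ k, g₀ k ≠ 0 → (∀ x ∈ cell ℓ k, ∀ y ∈ cell ℓ k, ∀ i, dist (x i) (y i) < ε) ∧
      ∀ y ∈ cell ℓ k, (∀ i j, i ≠ j → α / 2 ≤ dist (y i) (y j)) ∧ ∀ i, dist (y i) o ≤ R + 1 := by
    intro k hk
    obtain ⟨hkF, x, hx, hxS⟩ := hgood k hk
    have hclose : ∀ x ∈ cell ℓ k, ∀ y ∈ cell ℓ k, ∀ i, dist (x i) (y i) < ε := by
      intro x hx y hy i
      refine hdiam _ _ ?_ ?_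
      · rw [mem_cell.1 hx i, mem_cell.1 hy i]
      · rw [mem_cell.1 hx i]; exact hkF i
    refine ⟨hclose, fun y hy => ⟨fun i j hij => ?_, fun i => ?_⟩⟩
    · have h1 : α ≤ dist (x i) (x j) := by
        by_contra h
        exact hxS (Or.inl ⟨i, j, hij, not_le.1 h⟩)
      have h2 := dist_triangle4 (x i) (y i) (y j) (x j)
      have h3 := hclose x hx y hy i
      have h4 := hclose y hy x hx j
      linarith
    · have h1 : dist (x i) o ≤ R := by
        by_contra h
        exact hxS (Or.inr ⟨i, not_le.1 h⟩)
      have h2 := dist_triangle (y i) (x i) o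
      have h3 := hclose y hy x hx i
      linarith
  set W₀ : (Fin N → Bool × Fin (P + 1)) → ℝ≥0∞ := fun k => ENNReal.ofReal (g₀ k) with hW₀
  set E : (Fin N → Bool × Fin (P + 1)) → ℝ≥0∞ := fun k => ENNReal.ofReal (e k) with hE
  have hWadd : ∀ k, ENNReal.ofReal (g₀ k + e k) = W₀ k + E k := fun k =>
    ENNReal.ofReal_add (hg₀ k) (he k)
  have hW : ∀ (j : Fin N) (φ : Bool × Fin (P + 1) → ℝ≥0∞),
      ∑ k, (W₀ k + E k) * φ (k j) = ∑ l, μ (ℓ ⁻¹' {l}) * φ l := by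
    intro j φ
    simp_rw [← hWadd]
    exact sum_ofReal_mul (fun k => add_nonneg (hg₀ k) (he k)) (hmar j) φ
  have hpos : ∀ k, W₀ k + E k ≠ 0 → ∀ i, μ (ℓ ⁻¹' {k i}) ≠ 0 :=
    fiber_ne_zero_of_weight_ne_zero hW
  have hpos₀ : ∀ k, W₀ k ≠ 0 → ∀ i, μ (ℓ ⁻¹' {k i}) ≠ 0 := fun k hk =>
    hpos k fun h => hk (add_eq_zero.1 h).1
  have hposE : ∀ k, E k ≠ 0 → ∀ i, μ (ℓ ⁻¹' {k i}) ≠ 0 := fun k hk =>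
    hpos k fun h => hk (add_eq_zero.1 h).2
  have hW₀k : ∀ k, W₀ k ≠ 0 → g₀ k ≠ 0 := fun k hk h => hk (by simp [hW₀, h])
  have hEk : ∀ k, E k ≠ 0 → e k ≠ 0 := fun k hk h => hk (by simp [hE, h])
  have htop : ∀ k, W₀ k + E k ≠ ⊤ := fun k =>
    ENNReal.add_ne_top.2 ⟨ENNReal.ofReal_ne_top, ENNReal.ofReal_ne_top⟩
  set ν : Measure (Fin N → X) := blockMeasure μ ℓ fun k => W₀ k + E k with hν
  have hνadd : ν = blockMeasure μ ℓ W₀ + blockMeasure μ ℓ E := blockMeasure_add W₀ E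
  have hνmap : ∀ j, ν.map (fun x => x j) = μ := blockMeasure_map_eval hℓ hpos hW
  have hνprob : IsProbabilityMeasure ν := by
    constructor
    have h1 : ν.map (fun x => x 0) Set.univ = 1 := by rw [hνmap 0]; exact measure_univ
    rwa [Measure.map_apply (measurable_pi_apply 0) MeasurableSet.univ, Set.preimage_univ] at h1
  have hνσ : ∀ σ : Equiv.Perm (Fin N), ν.map (fun x => x ∘ σ) = ν := fun σ =>
    blockMeasure_map_perm σ fun k => by simp only [hW₀, hE, (hσ σ k).1, (hσ σ k).2]
  have hEmass : blockMeasure μ ℓ E Set.univ ≤ ENNReal.ofReal (N * δ) := by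
    rw [blockMeasure_univ hposE, hE, ← ENNReal.ofReal_sum_of_nonneg fun k _ => he k]
    exact ENNReal.ofReal_le_ofReal hem
  have hEnear : blockMeasure μ ℓ E (nearDiagonal X N r) = 0 := by
    refine blockMeasure_eq_zero hℓ fun k hk => Set.disjoint_left.2 fun x hx hxn => ?_
    obtain ⟨i, j, hij, h⟩ := hxn
    exact absurd h (not_lt.2 (hes k (hEk k hk) x hx i j hij))
  refine ⟨⟨⟨ν, hνprob⟩, hνσ⟩, hνmap, isBlock_of_eq_blockMeasure htop rfl,
    exists_blockMeasure_le hℓ htop hpos, ?_, ?_, ?_⟩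
  · refine ⟨min (α / 2) r, by positivity, ?_⟩
    change ν _ = 0
    rw [hνadd, Measure.add_apply, add_eq_zero]
    constructor
    · refine blockMeasure_eq_zero hℓ fun k hk => Set.disjoint_left.2 fun x hx hxn => ?_
      obtain ⟨i, j, hij, h⟩ := hxn
      exact absurd (h.trans_le (min_le_left _ _))
        (not_lt.2 (((hgoodcell k (hW₀k k hk)).2 x hx).1 i j hij))
    · refine measure_mono_null ?_ hEnear
      rintro x ⟨i, j, hij, h⟩
      exact ⟨i, j, hij, h.trans_le (min_le_right _ _)⟩
  · change ∫⁻ x, compCost f o x ∂ν ≤ _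
    have hWγ : ∀ k, W₀ k ≤ (γ.1 : Measure (Fin N → X)) (cell ℓ k) := fun k =>
      ENNReal.ofReal_le_of_le_toReal (hle k)
    have h1 : ∫⁻ x, compCost f o x ∂(blockMeasure μ ℓ W₀) ≤
        ∫⁻ x, compCost f o x ∂(γ.1 : Measure (Fin N → X)) + ENNReal.ofReal (η / 2) := by
      refine (lintegral_blockMeasure_le hℓ hpos₀ hWγ
        (Ψ := fun x => compCost f o x + ENNReal.ofReal (η / 2)) ?_).trans (le_of_eq ?_)
      · intro k hk x hx y hy
        have h := hgoodcell k (hW₀k k hk)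
        exact hunif x y (h.2 x hx).1 (h.2 y hy).1 (h.2 x hx).2 (h.2 y hy).2
          fun i => (h.1 x hx y hy i).trans_le hεε₀
      · rw [lintegral_add_right _ measurable_const, lintegral_const, measure_univ, mul_one]
    have h2 : ∫⁻ x, compCost f o x ∂(blockMeasure μ ℓ E) ≤ ENNReal.ofReal (η / 2) := by
      have hEle : blockMeasure μ ℓ E ≤ ν := by
        rw [hνadd]
        exact Measure.le_add_left le_rfl
      refine (lintegral_compCost_le_of_separated hf o hr hEnear (ζ := ENNReal.ofReal ζ)
        fun i => hδ' _ ?_ ?_).trans ?_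
      · exact (Measure.map_mono hEle (measurable_pi_apply i)).trans (hνmap i).le
      · rw [Measure.map_apply (measurable_pi_apply i) MeasurableSet.univ, Set.preimage_univ]
        exact hEmass.trans (ENNReal.ofReal_le_ofReal hδδ')
      · rw [← hc]
        calc (c : ℝ≥0∞) * (ENNReal.ofReal |f r| * blockMeasure μ ℓ E Set.univ +
              (ENNReal.ofReal ζ + ENNReal.ofReal ζ)) ≤
              (c : ℝ≥0∞) * (ENNReal.ofReal |f r| * ENNReal.ofReal (N * δ) +
              (ENNReal.ofReal ζ + ENNReal.ofReal ζ)) := by gcongr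
          _ = ENNReal.ofReal (c * (|f r| * (N * δ) + (ζ + ζ))) := by
              rw [← ENNReal.ofReal_natCast, ← ENNReal.ofReal_mul (abs_nonneg _),
                ← ENNReal.ofReal_add hζ0.le hζ0.le, ← ENNReal.ofReal_add (by positivity)
                (by positivity), ← ENNReal.ofReal_mul (Nat.cast_nonneg _)]
          _ ≤ _ := by
              refine ENNReal.ofReal_le_ofReal ?_
              have h3 : c * (ζ + ζ) ≤ η / 4 := by
                have : c * (ζ + ζ) = c * η / (4 * (c + 1)) := by
                  rw [hζ]; field_simp; ring
                rw [this, div_le_div_iff₀ (by positivity) (by norm_num)]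
                nlinarith
              rw [mul_add]
              linarith
    rw [hνadd, lintegral_add_measure]
    refine (add_le_add h1 h2).trans (le_of_eq ?_)
    rw [add_assoc, ← ENNReal.ofReal_add (by positivity) (by positivity), add_halves]
  · intro F hF
    change ν F ≤ _
    have hWγ : ∀ k, W₀ k ≤ (γ.1 : Measure (Fin N → X)) (cell ℓ k) := fun k =>
      ENNReal.ofReal_le_of_le_toReal (hle k)
    rw [hνadd, Measure.add_apply]
    refine add_le_add ?_ ?_
    · have h1 := lintegral_blockMeasure_le hℓ hpos₀ hWγ (Φ := F.indicator 1)
        (Ψ := (Metric.thickening η F).indicator 1) ?_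
      · rwa [lintegral_indicator_one hF,
          lintegral_indicator_one Metric.isOpen_thickening.measurableSet] at h1
      · intro k hk x hx y hy
        by_cases hxF : x ∈ F
        · have hyF : y ∈ Metric.thickening η F := by
            refine Metric.mem_thickening_iff.2 ⟨x, hxF, ?_⟩
            exact (dist_pi_lt_iff hη).2 fun i =>
              ((hgoodcell k (hW₀k k hk)).1 y hy x hx i).trans_le hεη
          rw [Set.indicator_of_mem hxF, Set.indicator_of_mem hyF]
          simp
        · rw [Set.indicator_of_notMem hxF]
          exact zero_le
    · exact ((measure_mono (Set.subset_univ F)).trans hEmass).trans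
        (ENNReal.ofReal_le_ofReal hδη)

end

/-! ### Recovery sequences -/

/-- Diagonal choice: if every `k` is eventually admissible, some sequence `φ n → ∞` is. -/
theorem exists_tendsto_diagonal (p : ℕ → ℕ → Prop) (hp : ∀ k, ∀ᶠ n in atTop, p n k) :
    ∃ φ : ℕ → ℕ, Tendsto φ atTop atTop ∧ ∀ᶠ n in atTop, p n (φ n) := by
  classical
  set q : ℕ → ℕ → Prop := fun n k => ∀ m ≥ n, p m k with hq
  refine ⟨fun n => Nat.findGreatest (q n) n, tendsto_atTop.2 fun k => ?_, ?_⟩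
  · obtain ⟨n₀, hn₀⟩ := eventually_atTop.1 (hp k)
    filter_upwards [eventually_ge_atTop n₀, eventually_ge_atTop k] with n h1 h2
    exact Nat.le_findGreatest h2 fun m hm => hn₀ m (h1.trans hm)
  · obtain ⟨n₀, hn₀⟩ := eventually_atTop.1 (hp 0)
    filter_upwards [eventually_ge_atTop n₀] with n h1
    exact Nat.findGreatest_spec (P := q n) (Nat.zero_le n) (fun m hm => hn₀ m (h1.trans hm)) n le_rfl

/-- One of the two inequalities of the Lévy–Prokhorov distance is enough for narrow convergence. -/
theorem tendsto_of_forall_le_thickening {Ω : Type*} [MetricSpace Ω] [MeasurableSpace Ω]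
    [BorelSpace Ω] {γ : ProbabilityMeasure Ω} {γs : ℕ → ProbabilityMeasure Ω} {η : ℕ → ℝ}
    (hη0 : ∀ n, 0 < η n) (hη : Tendsto η atTop (𝓝 0))
    (h : ∀ n F, MeasurableSet F → (γs n : Measure Ω) F ≤
      (γ : Measure Ω) (Metric.thickening (η n) F) + ENNReal.ofReal (η n)) :
    Tendsto γs atTop (𝓝 γ) := by
  refine tendsto_of_forall_isClosed_limsup_le' fun F hF => ?_
  have h1 : Tendsto (fun n => (γ : Measure Ω) (Metric.thickening (η n) F)) atTop
      (𝓝 ((γ : Measure Ω) F)) := by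
    refine (tendsto_measure_thickening_of_isClosed ⟨1, one_pos, measure_ne_top _ _⟩ hF).comp ?_
    exact tendsto_nhdsWithin_iff.2 ⟨hη, Eventually.of_forall hη0⟩
  have h2 : Tendsto (fun n => (γ : Measure Ω) (Metric.thickening (η n) F) + ENNReal.ofReal (η n))
      atTop (𝓝 ((γ : Measure Ω) F)) := by
    have := h1.add ((ENNReal.continuous_ofReal.tendsto 0).comp hη)
    simpa using this
  rw [← h2.limsup_eq]
  exact limsup_le_limsup (Eventually.of_forall fun n => h n F hF.measurableSet)

section

variable {X : Type*} [MetricSpace X] [PolishSpace X] [MeasurableSpace X] [BorelSpace X] {N : ℕ}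

/-- The recovery sequence at a coupling of finite cost: block approximations, chosen so slowly that
`τ n` times the entropy tends to zero. -/
theorem exists_recovery_sequence {m : Measure X} [SigmaFinite m] (hN : 2 ≤ N) {ρ : X → ℝ}
    (hρ : Measurable ρ) (hρ0 : ∀ x, 0 ≤ ρ x) [IsProbabilityMeasure (densityMeasure m ρ)]
    (hlog : Integrable (fun x => ρ x * Real.log (ρ x)) m) {f : ℝ → ℝ} (hf : IsRepulsive f) {o : X}
    (hA : ConditionA N (densityMeasure m ρ))
    (hμ : ∫⁻ x, ENNReal.ofReal (tailWeight f o x) ∂(densityMeasure m ρ) ≠ ⊤) {τ : ℕ → ℝ}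
    (hτ0 : Tendsto τ atTop (𝓝 0)) {γ : SymProb X N} (hγ : IsCoupling (densityMeasure m ρ) γ.1)
    (hfin : transportCost f γ.1 < ⊤) :
    ∃ u : ℕ → SymProb X N, Tendsto u atTop (𝓝 γ) ∧
      (∀ n, IsCoupling (densityMeasure m ρ) (u n).1 ∧ IsBlock (u n).1 ∧
        entropy m (u n).1 < ⊤ ∧
        ∃ α : ℝ, 0 < α ∧ ((u n).1 : Measure (Fin N → X)) (nearDiagonal X N α) = 0) ∧
      Tendsto (fun n => transportCost f (u n).1) atTop (𝓝 (transportCost f γ.1)) ∧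
      limsup (fun n => regularizedFunctional m ρ f (τ n) (u n)) atTop
        ≤ limitFunctional m ρ f γ := by
  have hI : ∫⁻ x, compCost f o x ∂(γ.1 : Measure (Fin N → X)) ≠ ⊤ := by
    intro h
    rw [hf.transportCost_eq o hμ hγ, h, EReal.coe_ennreal_top,
      ← EReal.coe_ennreal_toReal (compensationConst_ne_top hμ), EReal.top_sub_coe] at hfin
    exact lt_irrefl _ hfin
  have hη : ∀ k : ℕ, (0 : ℝ) < 1 / ((k : ℝ) + 1) := fun k => Nat.one_div_pos_of_nat
  choose v hvc hvb hvC hvα hvI hvF using fun k : ℕ =>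
    exists_block_approximation hN hA hf hμ hγ hI (hη k)
  have hv : Tendsto v atTop (𝓝 γ) := tendsto_subtype_rng.2
    (tendsto_of_forall_le_thickening hη tendsto_one_div_add_atTop_nhds_zero_nat hvF)
  have hve : ∀ k, entropy m (v k).1 < ⊤ := by
    intro k
    obtain ⟨C, hC, hle⟩ := hvC k
    exact (hvc k).entropy_lt_top hρ hρ0 hlog hC hle
  have hvT : Tendsto (fun k => transportCost f (v k).1) atTop (𝓝 (transportCost f γ.1)) := by
    simp_rw [hf.transportCost_eq o hμ (hvc _), hf.transportCost_eq o hμ hγ]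
    refine ((continuous_coe_sub (compensationConst_ne_top hμ)).tendsto _).comp ?_
    refine tendsto_of_le_liminf_of_limsup_le
      (lintegral_le_liminf_of_tendsto (tendsto_subtype_rng.1 hv) (hf.continuous_compCost o)) ?_
    have h1 : Tendsto (fun k : ℕ => ∫⁻ x, compCost f o x ∂(γ.1 : Measure (Fin N → X)) +
        ENNReal.ofReal (1 / ((k : ℝ) + 1))) atTop
        (𝓝 (∫⁻ x, compCost f o x ∂(γ.1 : Measure (Fin N → X)))) := by
      have := ((ENNReal.continuous_ofReal.tendsto 0).comp
        tendsto_one_div_add_atTop_nhds_zero_nat).const_add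
        (∫⁻ x, compCost f o x ∂(γ.1 : Measure (Fin N → X)))
      simpa using this
    rw [← h1.limsup_eq]
    exact limsup_le_limsup (Eventually.of_forall hvI)
  have hent : ∀ k, entropy m (v k).1 = ((entropy m (v k).1).toReal : EReal) := fun k =>
    (EReal.coe_toReal (hve k).ne ((hvc k).bot_lt_entropy hρ hρ0 hlog).ne').symm
  obtain ⟨φ, hφ, hφE⟩ := exists_tendsto_diagonal
    (fun n k => τ n * (entropy m (v k).1).toReal ≤ 1 / ((k : ℝ) + 1)) fun k => by
      have h1 : Tendsto (fun n => τ n * (entropy m (v k).1).toReal) atTop (𝓝 0) := by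
        simpa using hτ0.mul_const (entropy m (v k).1).toReal
      exact (h1.eventually_lt_const (hη k)).mono fun n hn => hn.le
  refine ⟨fun n => v (φ n), hv.comp hφ, fun n => ⟨hvc _, hvb _, hve _, hvα _⟩, hvT.comp hφ, ?_⟩
  have hbound : ∀ᶠ n in atTop, regularizedFunctional m ρ f (τ n) (v (φ n)) ≤
      transportCost f (v (φ n)).1 + ((1 / ((φ n : ℝ) + 1) : ℝ) : EReal) := by
    filter_upwards [hφE] with n hn
    unfold regularizedFunctional
    rw [if_pos (hvc _), hent, ← EReal.coe_mul]
    exact add_le_add le_rfl (EReal.coe_le_coe_iff.2 hn)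
  have hlim : Tendsto (fun n => transportCost f (v (φ n)).1 +
      ((1 / ((φ n : ℝ) + 1) : ℝ) : EReal)) atTop (𝓝 (transportCost f γ.1)) := by
    have h1 : Tendsto (fun n => ((1 / ((φ n : ℝ) + 1) : ℝ) : EReal)) atTop (𝓝 ((0 : ℝ) : EReal)) :=
      (continuous_coe_real_ereal.tendsto 0).comp
        (tendsto_one_div_add_atTop_nhds_zero_nat.comp hφ)
    have h2 : ContinuousAt (fun p : EReal × EReal => p.1 + p.2)
        (transportCost f γ.1, ((0 : ℝ) : EReal)) :=
      EReal.continuousAt_add (Or.inr (by simp)) (Or.inr (by simp))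
    have h3 := h2.tendsto.comp ((hvT.comp hφ).prodMk_nhds h1)
    simpa [Function.comp_def] using h3
  unfold limitFunctional
  rw [if_pos hγ, ← hlim.limsup_eq]
  exact limsup_le_limsup hbound

end

end RepulsiveOT

end

open RepulsiveOT in
theorem theorem3p1 {X : Type*} [MetricSpace X] [PolishSpace X] [MeasurableSpace X] [BorelSpace X]
    (m : Measure X) [SigmaFinite m] (N : ℕ) (hN : 2 ≤ N)
    (ρ : X → ℝ) (hρ_meas : Measurable ρ) (hρ_nonneg : ∀ x, 0 ≤ ρ x)
    (hρ_prob : IsProbabilityMeasure (densityMeasure m ρ))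
    (hρ_log : Integrable (fun x => ρ x * Real.log (ρ x)) m)
    (f : ℝ → ℝ) (hf : IsRepulsive f)
    (hA : ConditionA N (densityMeasure m ρ)) (hB : ConditionB f (densityMeasure m ρ))
    (τ : ℕ → ℝ) (hτ_pos : ∀ n, 0 < τ n) (hτ_anti : Antitone τ)
    (hτ_lim : Tendsto τ atTop (𝓝 0)) :
    -- the functionals take values in `(-∞, +∞]`
    (∀ γ : SymProb X N, ⊥ < limitFunctional m ρ f γ ∧
      ∀ n, ⊥ < regularizedFunctional m ρ f (τ n) γ) ∧
    -- Gamma-convergence in the space of symmetric probability measures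
    GammaConverges (fun n (γ : SymProb X N) => regularizedFunctional m ρ f (τ n) γ)
      (limitFunctional m ρ f) ∧
    -- where the limit is finite, there is a recovery sequence of symmetric block couplings
    (∀ γ : SymProb X N, IsCoupling (densityMeasure m ρ) γ.1 → transportCost f γ.1 < ⊤ →
      ∃ u : ℕ → SymProb X N, Tendsto u atTop (𝓝 γ) ∧
        (∀ n, IsCoupling (densityMeasure m ρ) (u n).1 ∧ IsBlock (u n).1 ∧
          entropy m (u n).1 < ⊤ ∧
          ∃ α : ℝ, 0 < α ∧ ((u n).1 : Measure (Fin N → X)) (nearDiagonal X N α) = 0) ∧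
        Tendsto (fun n => transportCost f (u n).1) atTop (𝓝 (transportCost f γ.1)) ∧
        limsup (fun n => regularizedFunctional m ρ f (τ n) (u n)) atTop
          ≤ limitFunctional m ρ f γ) := by
  obtain ⟨o, hμ⟩ := hf.exists_lintegral_tailWeight_ne_top hB
  refine ⟨fun γ => ⟨(bot_lt_functionals hρ_meas hρ_nonneg hρ_log hf hμ (hτ_pos 0) γ).1,
    fun n => (bot_lt_functionals hρ_meas hρ_nonneg hρ_log hf hμ (hτ_pos n) γ).2⟩,
    ⟨fun γ u hu => limitFunctional_le_liminf hρ_meas hρ_nonneg hρ_log hf hμ hτ_pos hτ_lim hu,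
      fun γ => ?_⟩,
    fun γ hγ hfin => exists_recovery_sequence hN hρ_meas hρ_nonneg hρ_log hf hA hμ hτ_lim hγ hfin⟩
  by_cases h : IsCoupling (densityMeasure m ρ) γ.1 ∧ transportCost f γ.1 < ⊤
  · obtain ⟨u, hu, -, -, hle⟩ :=
      exists_recovery_sequence hN hρ_meas hρ_nonneg hρ_log hf hA hμ hτ_lim h.1 h.2
    exact ⟨u, hu, hle⟩
  · -- where the limit functional is infinite, the constant sequence is a recovery sequence
    refine ⟨fun _ => γ, tendsto_const_nhds, ?_⟩
    have htop : limitFunctional m ρ f γ = ⊤ := by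
      unfold limitFunctional
      split_ifs with hc
      · exact not_lt_top_iff.1 fun hlt => h ⟨hc, hlt⟩
      · rfl
    rw [htop]
    exact le_top
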